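/- Let $K$ be a field and let $(\varphi_i(t),\psi_i(u))$, $i=1,\dots,n$, be pairs of power series over $K$ without constant term such that $$R=K[[(\varphi_1(t),\psi_1(u)),\dots,(\varphi_n(t),\psi_n(u))]]\subseteq K[[t]]\times K[[u]]$$ is an algebroid curve with two branches and integral closure $K[[t]]\times K[[u]]$. That is, with $P_1,P_2$ the kernels of the substitutions $x_i\mapsto\varphi_i(t)$ and $x_i\mapsto\psi_i(u)$ on $K[[x_1,\dots,x_n]]$, so that $R\cong K[[x_1,\dots,x_n]]/(P_1\cap P_2)$, neither of $P_1,P_2$ contains the other, and the branches $R^1=K[[\varphi_1,\dots,\varphi_n]]$, $R^2=K[[\psi_1,\dots,\psi_n]]$ have fraction fields $K((t))$, $K((u))$. For a subring $A\supseteq K$ of $B=K[[t]]$ or of $B=K[[t]]\times K[[u]]$, call $A$ Arf if for every $x\in A$ that is not a zero divisor of $B$ the set $\{v\in B: xv\in A\}$ is a ring (it is $x^{-1}A(\alpha)$, where $\alpha=\nu(x)$ is the vector of the orders of $x$ and $A(\alpha)$ is the set of elements of $A$ of value $\ge\alpha$). Let $A^*$ be the smallest Arf ring with $A\subseteq A^*\subseteq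 B$. The conductor of a set $S\subseteq\mathbb N^d$ of values is the least $\delta$ with $\delta+\mathbb N^d\subseteq S$. For $i=1,2$ let $M_i[1],M_i[2],\dots$ be the multiplicities of the rings in the sequence of iterated blow-ups of $R^i$. Here the multiplicity of a branch is the least order of a nonzero element of its maximal ideal $\mathfrak m$, and its blow-up is the ring generated by $x^{-1}\mathfrak m$ with $x\in\mathfrak m$ of least order. Let $l_i$ be the last index $j$ with $M_i[j]\ne1$ ($l_i=1$ if there is none), let $s_{i,k}\ge k+1$ be the index with $M_i[k]=\sum_{j=k+1}^{s_{i,k}}M_i[j]$, and put $$D(1,2)=\{1\le k\le\max(l_1,l_2): s_{1,k}\ne s_{2,k}\},\qquad \mathrm{Dis}(1,2)=\{i:\operatorname{ord}\varphi_i\ne\operatorname{ord}\psi_i\}.$$ The set $D(1,2)$ is empty exactly when $M_1=M_2$. * If $D(1,2)\neq\emptyset$, let $k_E=\min_{k\in D(1,2)}\min(s_{1,k},s_{2,k})$, $d_i=\max(l_i,k_E)$, and $b_O=\big(1+\sum_{j=1}^{d_1}M_1[j],\,1+\sum_{j=1}^{d_2}M_2[j]\big)$. * If $D(1,2)=\emptyset$,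 let $c_r$ be the common conductor of $\nu((R^1)^*)$ and $\nu((R^2)^*)$. If moreover $\mathrm{Dis}(1,2)\ne\emptyset$, let $D=\min_{i\in \mathrm{Dis}(1,2)}\min(\operatorname{ord}\varphi_i,\operatorname{ord}\psi_i)$ and $b_D=(\max\{c_r,D\}+1,\max\{c_r,D\}+1)$. * If $D(1,2)=\emptyset$, a vector $b_G$ is obtained as follows. In one step, choose indices $p\neq q$ with $\varphi_p(t)\ne\psi_p(t)$ or $\varphi_q(t)\neq\psi_q(t)$, and replace the generator $(\varphi_p,\psi_p)$ by an element $(\tilde\varphi,\tilde\psi)=\alpha(\varphi_p,\psi_p)^r+\beta(\varphi_q,\psi_q)^s$ with $\alpha,\beta\in K$, $r,s\ge1$ and $\operatorname{ord}\tilde\varphi>\operatorname{ord}\varphi_p$. Finitely many (possibly zero) steps give generators of a ring $\tilde R\subseteq R$. Then $b_G$ is any of the following vectors: if $\tilde R$ is again an algebroid curve with integral closure $K[[t]]\times K[[u]]$, the vector $b_O$ of $\tilde R$ if $D(1,2)\ne\emptyset$ for $\tilde R$, and the vector $b_D$ of $\tilde R$ if $D(1,2)=\emptyset$ and $\mathrm{Dis}(1,2)\neq\emptyset$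 for $\tilde R$; and, whenever the generators of $\tilde R$ have a discrepancy ($\mathrm{Dis}(1,2)\ne\emptyset$), of smallest order $\tilde D$, the vector $(\max\{c_r,\tilde D\}+1,\max\{c_r,\tilde D\}+1)$ with $c_r$ that of $R$. Let $b_G$ be any vector obtained in this way, and let $$b=\begin{cases} b_O &\text{if } D(1,2)\neq\emptyset,\\ \min\{b_D,b_G\}\ \text{(componentwise)} &\text{if } D(1,2)=\emptyset \text{ and } \mathrm{Dis}(1,2)\ne\emptyset,\\ b_G&\text{if } D(1,2)=\emptyset\text{ and }\mathrm{Dis}(1,2)=\emptyset.\end{cases}$$ Then $\nu(R^*)$ has a conductor $c=(c[1],c[2])$, and $b\ge(c[1]+1,c[2]+1)$ componentwise. -/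

import Mathlib

noncomputable section

namespace AlgebroidCurve

variable {K : Type*} [Field K]

/-! ### Arf closure -/

section Arf

variable {B : Type*} [CommRing B] [Algebra K B]

/-- Here `B` is the integral closure of `A` (`K[[t]]` for a branch, `K[[t]] × K[[u]]` for a curve
with two branches). For a nonzerodivisor `x ∈ A` of value `α`, the set `x⁻¹ A(α)`, where
`A(α) = {y ∈ A : ν(y) ≥ α}`, is `{v ∈ B : x v ∈ A}`. The ring `A` is Arf when all these sets are
rings; they always are additive groups that contain `1`. -/
def IsArf (A : Subalgebra K B) : Prop :=
  ∀ x ∈ A, x ∈ nonZeroDivisors B → ∀ v w : B, x * v ∈ A → x * w ∈ A → x * (v * w) ∈ A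

/-- The smallest Arf ring containing `A`. -/
def arfClosure (A : Subalgebra K B) : Subalgebra K B :=
  sInf {A' | IsArf A' ∧ A ≤ A'}

theorem isArf_arfClosure (A : Subalgebra K B) : IsArf (arfClosure A) := by
  intro x hx hx0 v w hv hw
  simp only [arfClosure, Algebra.mem_sInf, Set.mem_ofPred_eq] at *
  exact fun A' hA' => hA'.1 x (hx A' hA') hx0 v w (hv A' hA') (hw A' hA')

theorem le_arfClosure (A : Subalgebra K B) : A ≤ arfClosure A :=
  le_sInf fun _ h => h.2

end Arf

/-! ### Branches: multiplicity sequence and conductor -/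

/-- The multiplicity of a branch `A ⊆ K[[t]]`: the least order of a nonzero element of its maximal
ideal `{f ∈ A : f(0) = 0}`. -/
def mult (A : Subalgebra K (PowerSeries K)) : ℕ :=
  sInf {d : ℕ | 1 ≤ d ∧ ∃ f ∈ A, f.order = (d : ℕ∞)}

/-- The blow-up of a branch `A` with maximal ideal `m`: the ring generated by `x⁻¹ m`, where `x` is
an element of minimal order of `m` (the ring does not depend on the choice of `x`). -/
def blowUp (A : Subalgebra K (PowerSeries K)) : Subalgebra K (PowerSeries K) :=
  Algebra.adjoin K {z | ∃ x ∈ A, 1 ≤ mult A ∧ x.order = (mult A : ℕ∞) ∧ x * z ∈ A}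

/-- The multiplicity sequence `M[1], M[2], …` of a branch: the multiplicities of the rings in its
sequence of blow-ups `A = A₁ ⊆ A₂ ⊆ …`. (The value at `0` is not used.) -/
def multSeq (A : Subalgebra K (PowerSeries K)) (j : ℕ) : ℕ :=
  mult (blowUp^[j - 1] A)

/-- The length of a multiplicity sequence: the last `j ≥ 1` with `M[j] ≠ 1`, and `1` if there is
none. -/
def seqLength (M : ℕ → ℕ) : ℕ :=
  max 1 (sSup {j : ℕ | 1 ≤ j ∧ M j ≠ 1})

/-- The index `s ≥ k + 1` with `M[k] = M[k+1] + ⋯ + M[s]`. -/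
def sIndex (M : ℕ → ℕ) (k : ℕ) : ℕ :=
  sInf {s : ℕ | k + 1 ≤ s ∧ M k = ∑ j ∈ Finset.Icc (k + 1) s, M j}

/-- The conductor of the value semigroup of the Arf closure of a branch. -/
def branchConductor (A : Subalgebra K (PowerSeries K)) : ℕ :=
  sInf {c : ℕ | ∀ m : ℕ, c ≤ m → ∃ f ∈ arfClosure A, f.order = (m : ℕ∞)}

/-! ### Curves with two branches -/

/-- The value semigroup `ν(A) ⊆ ℕ²` of `A ⊆ K[[t]] × K[[u]]`. -/
def valueSemigroup (A : Subalgebra K (PowerSeries K × PowerSeries K)) : Set (ℕ × ℕ) :=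
  {v | ∃ f ∈ A, f.1.order = (v.1 : ℕ∞) ∧ f.2.order = (v.2 : ℕ∞)}

/-- `c` is the conductor of `S ⊆ ℕ²`: the least `δ` with `δ + ℕ² ⊆ S`. -/
def IsConductor (S : Set (ℕ × ℕ)) (c : ℕ × ℕ) : Prop :=
  IsLeast {δ | ∀ β, δ ≤ β → β ∈ S} c

/-- `n` pairs `(φᵢ(t), ψᵢ(u))` of power series without constant term. -/
structure Parametrization (K : Type*) [Field K] (n : ℕ) where
  φ : Fin n → PowerSeries K
  ψ : Fin n → PowerSeries K
  φ_zero : ∀ i, PowerSeries.constantCoeff (φ i) = 0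
  ψ_zero : ∀ i, PowerSeries.constantCoeff (ψ i) = 0

namespace Parametrization

variable {n : ℕ}

theorem hasSubst_φ (P : Parametrization K n) : MvPowerSeries.HasSubst P.φ :=
  MvPowerSeries.hasSubst_of_constantCoeff_zero P.φ_zero

theorem hasSubst_ψ (P : Parametrization K n) : MvPowerSeries.HasSubst P.ψ :=
  MvPowerSeries.hasSubst_of_constantCoeff_zero P.ψ_zero

/-- The substitution `F ↦ F(φ₁(t), …, φₙ(t))` on `K[[x₁, …, xₙ]]`. -/
def hom₁ (P : Parametrization K n) : MvPowerSeries (Fin n) K →ₐ[K] PowerSeries K :=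
  MvPowerSeries.substAlgHom P.hasSubst_φ

/-- The substitution `F ↦ F(ψ₁(u), …, ψₙ(u))` on `K[[x₁, …, xₙ]]`. -/
def hom₂ (P : Parametrization K n) : MvPowerSeries (Fin n) K →ₐ[K] PowerSeries K :=
  MvPowerSeries.substAlgHom P.hasSubst_ψ

/-- The branch `R¹ = K[[φ₁(t), …, φₙ(t)]]`. -/
def branch₁ (P : Parametrization K n) : Subalgebra K (PowerSeries K) := P.hom₁.range

/-- The branch `R² = K[[ψ₁(u), …, ψₙ(u)]]`. -/
def branch₂ (P : Parametrization K n) : Subalgebra K (PowerSeries K) := P.hom₂.range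

/-- The ring `R = K[[(φ₁(t), ψ₁(u)), …, (φₙ(t), ψₙ(u))]]`. -/
def curveRing (P : Parametrization K n) : Subalgebra K (PowerSeries K × PowerSeries K) :=
  (P.hom₁.prod P.hom₂).range

/-- `R ≅ K[[x₁, …, xₙ]] / (P₁ ∩ P₂)` is an algebroid curve with exactly two branches and integral
closure `K[[t]] × K[[u]]`: the primes `P₁`, `P₂` (the kernels of the two substitutions) are
incomparable, and `K[[t]]`, `K[[u]]` lie in the fraction fields of `R¹`, `R²`. -/
structure IsAlgebroidCurve (P : Parametrization K n) : Prop where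
  not_le₁₂ : ¬ RingHom.ker P.hom₁ ≤ RingHom.ker P.hom₂
  not_le₂₁ : ¬ RingHom.ker P.hom₂ ≤ RingHom.ker P.hom₁
  frac₁ : ∀ f : PowerSeries K, ∃ a ∈ P.branch₁, ∃ b ∈ P.branch₁, b ≠ 0 ∧ b * f = a
  frac₂ : ∀ f : PowerSeries K, ∃ a ∈ P.branch₂, ∃ b ∈ P.branch₂, b ≠ 0 ∧ b * f = a

/-- The multiplicity sequence `M₁` of the first branch. -/
def M₁ (P : Parametrization K n) : ℕ → ℕ := multSeq P.branch₁

/-- The multiplicity sequence `M₂` of the second branch. -/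
def M₂ (P : Parametrization K n) : ℕ → ℕ := multSeq P.branch₂

/-- The set `D(1,2)` of the indices `1 ≤ k ≤ L = max(l₁, l₂)` with `s₁ₖ ≠ s₂ₖ`; it is empty exactly
when the two multiplicity sequences agree. -/
def D (P : Parametrization K n) : Set ℕ :=
  {k | 1 ≤ k ∧ k ≤ max (seqLength P.M₁) (seqLength P.M₂) ∧ sIndex P.M₁ k ≠ sIndex P.M₂ k}

/-- The number `k_E(1,2) = min {min(s₁ₖ, s₂ₖ) : k ∈ D(1,2)}`. -/
def kE (P : Parametrization K n) : ℕ :=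
  sInf ((fun k => min (sIndex P.M₁ k) (sIndex P.M₂ k)) '' P.D)

/-- The vector `b_O`. -/
def bO (P : Parametrization K n) : ℕ × ℕ :=
  ((∑ i ∈ Finset.Icc 1 (max (seqLength P.M₁) P.kE), P.M₁ i) + 1,
   (∑ i ∈ Finset.Icc 1 (max (seqLength P.M₂) P.kE), P.M₂ i) + 1)

/-- The set of discrepancies: the indices `i` with `ord φᵢ ≠ ord ψᵢ`. -/
def Dis (P : Parametrization K n) : Set (Fin n) :=
  {i | (P.φ i).order ≠ (P.ψ i).order}

/-- The smallest order that causes a discrepancy. -/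
def disOrder (P : Parametrization K n) : ℕ :=
  sInf {d : ℕ | ∃ i ∈ P.Dis, (d : ℕ∞) = min (P.φ i).order (P.ψ i).order}

/-- The conductor `c_r` of (the Arf closures of) the branches. It is only used when the two
multiplicity sequences agree, and then both branches have the same conductor. -/
def cr (P : Parametrization K n) : ℕ := branchConductor P.branch₁

/-- The vector `b_D`. -/
def bD (P : Parametrization K n) : ℕ × ℕ :=
  (max P.cr P.disOrder + 1, max P.cr P.disOrder + 1)

/-- One step `R ↦ R̃` of the manipulation of the generators: for generators `y_p ≠ y_q` that do not
both have equal components, `y_p` is replaced by some `a y_p ^ r + b y_q ^ s` whose first component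
has order greater than that of `y_p`. No ordering of the generators is prescribed, so this allows
in particular `p` to be the first and `q` the first suitable one in an increasing enumeration. -/
def Step (P Q : Parametrization K n) : Prop :=
  ∃ p q : Fin n, p ≠ q ∧ (P.φ p ≠ P.ψ p ∨ P.φ q ≠ P.ψ q) ∧
    (∃ (a b : K) (r s : ℕ), 1 ≤ r ∧ 1 ≤ s ∧
      Q.φ p = a • P.φ p ^ r + b • P.φ q ^ s ∧ Q.ψ p = a • P.ψ p ^ r + b • P.ψ q ^ s) ∧
    (P.φ p).order < (Q.φ p).order ∧
    ∀ j, j ≠ p → Q.φ j = P.φ j ∧ Q.ψ j = P.ψ j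

/-- `b` is a vector `b_G`: finitely many steps lead from `P` to a parametrization `Q` for which a
bound is known, and `b` is that bound. Either `Q` is again an algebroid curve, and `b` is its `b_O`
or its `b_D`; or `Q` just exhibits a discrepancy between the orders of an element of the original
ring, and its order is compared with the conductor of the original branches. -/
def IsBG (P : Parametrization K n) (b : ℕ × ℕ) : Prop :=
  ∃ Q : Parametrization K n, Relation.ReflTransGen Step P Q ∧
    ((Q.IsAlgebroidCurve ∧ Q.D.Nonempty ∧ b = Q.bO) ∨
     (Q.IsAlgebroidCurve ∧ Q.D = ∅ ∧ Q.Dis.Nonempty ∧ b = Q.bD) ∨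
     (Q.Dis.Nonempty ∧ b = (max P.cr Q.disOrder + 1, max P.cr Q.disOrder + 1)))

/-- The vector `b`, defined case by case; `⊓` is the componentwise minimum. It depends on the run of
the manipulation of the generators that gives `b_G`. -/
def IsBound (P : Parametrization K n) (b : ℕ × ℕ) : Prop :=
  (P.D.Nonempty ∧ b = P.bO) ∨
  (P.D = ∅ ∧ P.Dis.Nonempty ∧ ∃ bG, P.IsBG bG ∧ b = P.bD ⊓ bG) ∨
  (P.D = ∅ ∧ P.Dis = ∅ ∧ P.IsBG b)

end Parametrization

end AlgebroidCurve

end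

namespace AlgebroidCurve

variable {K : Type*} [Field K]

/-! ### Arf rings -/

section ArfRings

variable {B : Type*} [CommRing B] [Algebra K B]

/-! Everything is read off the chain of blow-ups of `C = R^*`. While a ring of the chain is local
(`IsGlued`), it equals `K + x C'`, where `x` has the least orders `(M₁[j], M₂[j])` in both
components and `C'` is the next ring, again Arf over the blown-up branches (`IsArfOver.blowUp`).
Since `R` contains `t^c K[[t]] × u^c K[[u]]` for some `c`, only a finite number `N` of rings are
local. The next one contains the idempotents `(1, 0)` and `(0, 1)`, hence the product of the Arf
closures of the two blown-up branches.

Two facts follow. If one order of an element of `C` is below the sum of the first `N` multiplicities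
of its branch, then the two orders are the sums of the first `i` multiplicities, with the same `i <
N` (`IsArfOver.exists_order_eq_sum`). And every vector whose components are at least the sums of the
first `max(l₁, N)` and `max(l₂, N)` multiplicities is a value (`IsArfOver.mem_valueSemigroup`). So
it remains to bound `N`.

For `b_O`: a minimal element of the `k`-th ring also lies in its blow-up. If `N` exceeded `min(s₁ₖ,
s₂ₖ)`, the first fact would write `M₁[k]` and `M₂[k]` as sums of equally many following
multiplicities, so `s₁ₖ = s₂ₖ` (`IsArfOver.le_min_sIndex`). For `b_D`: with equal multiplicity
sequences, an element with different orders cannot have its smaller order below the sum of the first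
`N` multiplicities; the sum of the first `l` is at most `c_r` unless all multiplicities are 1. For
`b_G`: steps only shrink the ring, and the Arf closure is monotone. Minima are harmless because such
bounds are closed under componentwise infimum (`inf_mem_conductors`), which also yields the
conductor. -/

theorem arfClosure_le {A C : Subalgebra K B} (hC : IsArf C) (h : A ≤ C) : arfClosure A ≤ C :=
  sInf_le ⟨hC, h⟩

theorem arfClosure_mono {A C : Subalgebra K B} (h : A ≤ C) : arfClosure A ≤ arfClosure C :=
  arfClosure_le (isArf_arfClosure C) (h.trans (le_arfClosure C))

/-- Since `x * y = 1` lies in `C`, the Arf condition gives `x * (y * y) = y`. -/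
theorem IsArf.mem_of_mul_eq_one {C : Subalgebra K B} (hC : IsArf C) {x y : B} (hx : x ∈ C)
    (hxy : x * y = 1) : y ∈ C := by
  have hn : x ∈ nonZeroDivisors B := (IsUnit.of_mul_eq_one y hxy).mem_nonZeroDivisors
  have h1 : x * y ∈ C := hxy ▸ C.one_mem
  have := hC x hx hn y y h1 h1
  rwa [← mul_assoc, hxy, one_mul] at this

/-- The ring `x⁻¹ C(ν(x))` for an element `x` of an Arf ring `C`. -/
def IsArf.divBy {C : Subalgebra K B} (hC : IsArf C) {x : B} (hx : x ∈ C)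
    (hx0 : x ∈ nonZeroDivisors B) : Subalgebra K B where
  carrier := {v | x * v ∈ C}
  mul_mem' := fun {v w} hv hw => hC x hx hx0 v w hv hw
  add_mem' := fun {v w} hv hw => by
    simp only [Set.mem_ofPred_eq, mul_add] at *
    exact C.add_mem hv hw
  algebraMap_mem' := fun r => C.mul_mem hx (C.algebraMap_mem r)

theorem IsArf.mem_divBy {C : Subalgebra K B} (hC : IsArf C) {x : B} (hx : x ∈ C)
    (hx0 : x ∈ nonZeroDivisors B) {v : B} : v ∈ hC.divBy hx hx0 ↔ x * v ∈ C := Iff.rfl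

theorem IsArf.isArf_divBy {C : Subalgebra K B} (hC : IsArf C) {x : B} (hx : x ∈ C)
    (hx0 : x ∈ nonZeroDivisors B) : IsArf (hC.divBy hx hx0) := by
  intro y hy hy0 v w hv hw
  simp only [IsArf.mem_divBy, ← mul_assoc] at *
  have := hC (x * y) hy (mul_mem hx0 hy0) v w hv hw
  rwa [← mul_assoc] at this

end ArfRings

/-! ### Orders of power series -/

section Order

open PowerSeries

theorem order_eq_zero_iff {f : PowerSeries K} : f.order = 0 ↔ constantCoeff f ≠ 0 := by
  rw [Ne, ← order_ne_zero_iff_constCoeff_eq_zero, not_not]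

theorem isUnit_of_constantCoeff_ne_zero {f : PowerSeries K} (h : constantCoeff f ≠ 0) :
    IsUnit f :=
  isUnit_iff_constantCoeff.2 (isUnit_iff_ne_zero.2 h)

theorem exists_mul_eq_of_order_le {x f : PowerSeries K} (hx : x ≠ 0) (h : x.order ≤ f.order) :
    ∃ g, f = x * g := by
  have hu : IsUnit (divXPowOrder x) := by
    apply isUnit_of_constantCoeff_ne_zero
    rw [constantCoeff_divXPowOrder]
    exact coeff_order hx
  obtain ⟨w, hw⟩ := hu.exists_right_inv
  obtain ⟨g, hg⟩ : (X : PowerSeries K) ^ x.order.toNat ∣ f := by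
    rw [X_pow_dvd_iff]
    intro m hm
    apply coeff_of_lt_order
    refine lt_of_lt_of_le ?_ h
    rw [← coe_toNat_order hx]
    exact_mod_cast hm
  refine ⟨w * g, ?_⟩
  conv_rhs => rw [← X_pow_order_mul_divXPowOrder (f := x)]
  rw [mul_assoc, ← mul_assoc _ w g, hw, one_mul, hg]

theorem ne_zero_of_order_eq_coe {f : PowerSeries K} {d : ℕ} (h : f.order = d) : f ≠ 0 := by
  rintro rfl
  simp at h

theorem order_eq_of_mul_eq {x f g : PowerSeries K} {d e : ℕ} (hx : x.order = d)
    (hf : f.order = (d + e : ℕ)) (h : f = x * g) : g.order = e := by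
  rw [h, order_mul, hx, Nat.cast_add] at hf
  exact (ENat.addLECancellable_natCast d).inj.1 hf

end Order

/-! ### Branches -/

section Branch

open PowerSeries

variable {A : Subalgebra K (PowerSeries K)}

theorem C_mem (A : Subalgebra K (PowerSeries K)) (a : K) : C a ∈ A :=
  A.algebraMap_mem a

theorem exists_order_eq_mult (h : 1 ≤ mult A) : ∃ f ∈ A, f.order = (mult A : ℕ∞) := by
  have hne : {d : ℕ | 1 ≤ d ∧ ∃ f ∈ A, f.order = (d : ℕ∞)}.Nonempty := by
    by_contra hc
    rw [Set.not_nonempty_iff_eq_empty] at hc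
    simp [mult, hc] at h
  exact (Nat.sInf_mem hne).2

theorem mult_le_of_order_eq {f : PowerSeries K} (hf : f ∈ A) {d : ℕ} (hd : 1 ≤ d)
    (h : f.order = d) : mult A ≤ d :=
  Nat.sInf_le ⟨hd, f, hf, h⟩

theorem one_le_mult {f : PowerSeries K} (hf : f ∈ A) {d : ℕ} (hd : 1 ≤ d)
    (h : f.order = d) : 1 ≤ mult A :=
  (Nat.sInf_mem (s := {d : ℕ | 1 ≤ d ∧ ∃ f ∈ A, f.order = (d : ℕ∞)}) ⟨d, hd, f, hf, h⟩).1

theorem mult_le_order {f : PowerSeries K} (hf : f ∈ A) (h0 : constantCoeff f = 0) :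
    (mult A : ℕ∞) ≤ f.order := by
  by_cases hz : f = 0
  · simp [hz]
  rw [← coe_toNat_order hz]
  have h1 : (1 : ℕ∞) ≤ f.order := one_le_order_iff_constCoeff_eq_zero.2 h0
  rw [← coe_toNat_order hz] at h1
  exact_mod_cast mult_le_of_order_eq hf (by exact_mod_cast h1) (coe_toNat_order hz).symm

theorem constantCoeff_eq_zero_of_order_eq_mult (h : 1 ≤ mult A) {x : PowerSeries K}
    (hx : x.order = mult A) : constantCoeff x = 0 := by
  rw [← one_le_order_iff_constCoeff_eq_zero, hx]
  exact_mod_cast h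

theorem mem_blowUp_of_mul_mem {x z : PowerSeries K} (h : 1 ≤ mult A) (hx : x ∈ A)
    (hxo : x.order = mult A) (hz : x * z ∈ A) : z ∈ blowUp A :=
  Algebra.subset_adjoin ⟨x, hx, h, hxo, hz⟩

theorem exists_mul_of_constantCoeff_eq_zero (h : 1 ≤ mult A) {x f : PowerSeries K} (hx : x ∈ A)
    (hxo : x.order = mult A) (hf : f ∈ A) (h0 : constantCoeff f = 0) :
    ∃ z ∈ blowUp A, f = x * z := by
  obtain ⟨z, hz⟩ := exists_mul_eq_of_order_le (ne_zero_of_order_eq_coe hxo)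
    (hxo ▸ mult_le_order hf h0)
  exact ⟨z, mem_blowUp_of_mul_mem h hx hxo (hz ▸ hf), hz⟩

theorem le_blowUp (h : 1 ≤ mult A) : A ≤ blowUp A := by
  obtain ⟨x, hx, hxo⟩ := exists_order_eq_mult h
  exact fun f hf => mem_blowUp_of_mul_mem h hx hxo (A.mul_mem hx hf)

theorem one_le_mult_blowUp (h : 1 ≤ mult A) : 1 ≤ mult (blowUp A) := by
  obtain ⟨x, hx, hxo⟩ := exists_order_eq_mult h
  exact one_le_mult (le_blowUp h hx) h hxo

theorem mult_blowUp_le (h : 1 ≤ mult A) : mult (blowUp A) ≤ mult A := by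
  obtain ⟨x, hx, hxo⟩ := exists_order_eq_mult h
  exact mult_le_of_order_eq (le_blowUp h hx) h hxo

/-- The ring `K + x C`. -/
def scalarAddMul (C : Subalgebra K (PowerSeries K)) {x : PowerSeries K} (hx : x ∈ C) :
    Subalgebra K (PowerSeries K) where
  carrier := {f | ∃ (k : K), ∃ c ∈ C, f = PowerSeries.C k + x * c}
  mul_mem' := by
    rintro _ _ ⟨k, c, hc, rfl⟩ ⟨k', c', hc', rfl⟩
    refine ⟨k * k', PowerSeries.C k * c' + PowerSeries.C k' * c + x * c * c', ?_, ?_⟩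
    · exact C.add_mem (C.add_mem (C.mul_mem (C_mem C k) hc') (C.mul_mem (C_mem C k') hc))
        (C.mul_mem (C.mul_mem hx hc) hc')
    · rw [map_mul]; ring
  add_mem' := by
    rintro _ _ ⟨k, c, hc, rfl⟩ ⟨k', c', hc', rfl⟩
    exact ⟨k + k', c + c', C.add_mem hc hc', by rw [map_add]; ring⟩
  algebraMap_mem' := fun r => ⟨r, 0, C.zero_mem, by simp⟩

/-- For a nonunit `y = x c` the factor `x` cancels and the Arf condition at `c` in `C` applies; a
unit `y` has its inverse in `K + x C`. -/
theorem isArf_scalarAddMul {C : Subalgebra K (PowerSeries K)} (hC : IsArf C) {x : PowerSeries K}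
    (hx : x ∈ C) (hx0 : constantCoeff x = 0) : IsArf (scalarAddMul C hx) := by
  rintro y hy hy0 v w hv hw
  -- For `x = 0` the ring is `K`; it is treated apart because `x` is cancelled below.
  by_cases hz : x = 0
  · obtain ⟨k, c, hc, rfl⟩ := hy
    obtain ⟨k1, c1, hc1, h1⟩ := hv
    obtain ⟨k2, c2, hc2, h2⟩ := hw
    simp only [hz, zero_mul, add_zero] at *
    have hk : k ≠ 0 := by
      rintro rfl
      simp at hy0
    refine ⟨k1 * k2 * k⁻¹, 0, C.zero_mem, ?_⟩
    have : PowerSeries.C k * PowerSeries.C k⁻¹ = 1 := by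
      rw [← map_mul, mul_inv_cancel₀ hk, map_one]
    simp only [zero_mul, add_zero, map_mul]
    rw [← h1, ← h2]
    linear_combination (- PowerSeries.C k * v * w) * this
  obtain ⟨k, c, hc, rfl⟩ := hy
  by_cases hk : k = 0
  · subst hk
    simp only [map_zero, zero_add] at *
    have key : ∀ v, x * c * v ∈ scalarAddMul C hx → c * v ∈ C := by
      rintro v ⟨k, d, hd, h⟩
      have hk : k = 0 := by
        have := congrArg constantCoeff h
        simpa [hx0] using this.symm
      rw [hk, map_zero, zero_add, mul_assoc] at h
      rwa [mul_left_cancel₀ hz h]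
    have hc0 : c ∈ nonZeroDivisors (PowerSeries K) := by
      rw [mem_nonZeroDivisors_iff_ne_zero] at *
      exact right_ne_zero_of_mul hy0
    exact ⟨0, c * (v * w), hC c hc hc0 v w (key v hv) (key w hw), by simp [mul_assoc]⟩
  · set y := PowerSeries.C k + x * c with hydef
    have hyS : y ∈ scalarAddMul C hx := ⟨k, c, hc, rfl⟩
    have hyu : IsUnit y := isUnit_of_constantCoeff_ne_zero (by simp [hydef, hx0, hk])
    obtain ⟨y', hy'⟩ := hyu.exists_right_inv
    have hy'C : y' ∈ C :=
      hC.mem_of_mul_eq_one (C.add_mem (C_mem C k) (C.mul_mem hx hc)) hy'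
    have hkk : PowerSeries.C k * PowerSeries.C k⁻¹ = 1 := by
      rw [← map_mul, mul_inv_cancel₀ hk, map_one]
    have hy'S : y' ∈ scalarAddMul C hx := by
      -- Solve `(k + x c) y' = 1` for `y' = k⁻¹ - x (k⁻¹ c y')`.
      refine ⟨k⁻¹, - (PowerSeries.C k⁻¹ * c * y'),
        C.neg_mem (C.mul_mem (C.mul_mem (C_mem C _) hc) hy'C), ?_⟩
      rw [hydef] at hy'
      linear_combination (PowerSeries.C k⁻¹) * hy' - y' * hkk
    have : y * (v * w) = y' * ((y * v) * (y * w)) := by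
      linear_combination (- (y * v * w)) * hy'
    rw [this]
    exact mul_mem hy'S (mul_mem hv hw)

theorem arfClosure_le_scalarAddMul (h : 1 ≤ mult A) {x : PowerSeries K} (hx : x ∈ A)
    (hxo : x.order = mult A) :
    arfClosure A ≤ scalarAddMul (arfClosure (blowUp A)) (le_arfClosure _ (le_blowUp h hx)) := by
  refine arfClosure_le (isArf_scalarAddMul (isArf_arfClosure _) _
    (constantCoeff_eq_zero_of_order_eq_mult h hxo)) fun f hf => ?_
  obtain ⟨z, hz, hfz⟩ := exists_mul_of_constantCoeff_eq_zero (f := f - C (constantCoeff f)) h hx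
    hxo (A.sub_mem hf (C_mem A _)) (by simp)
  exact ⟨constantCoeff f, z, le_arfClosure _ hz, by rw [← hfz]; ring⟩

theorem exists_mul_of_mem_arfClosure (h : 1 ≤ mult A) {x f : PowerSeries K} (hx : x ∈ A)
    (hxo : x.order = mult A) (hf : f ∈ arfClosure A) (h0 : constantCoeff f = 0) :
    ∃ z ∈ arfClosure (blowUp A), f = x * z := by
  obtain ⟨k, c, hc, rfl⟩ := arfClosure_le_scalarAddMul h hx hxo hf
  have hx0 := constantCoeff_eq_zero_of_order_eq_mult h hxo
  have hk : k = 0 := by simpa [hx0] using h0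
  exact ⟨c, hc, by simp [hk]⟩

theorem mult_le_order_of_mem_arfClosure (h : 1 ≤ mult A) {f : PowerSeries K}
    (hf : f ∈ arfClosure A) (h0 : constantCoeff f = 0) : (mult A : ℕ∞) ≤ f.order := by
  obtain ⟨x, hx, hxo⟩ := exists_order_eq_mult h
  obtain ⟨z, -, rfl⟩ := exists_mul_of_mem_arfClosure h hx hxo hf h0
  rw [order_mul, hxo]
  exact le_self_add

/-- Blowing up commutes with Arf closure. One inclusion holds because `x⁻¹ A^*(ν(x))` is Arf and
contains the generators of the blow-up, the other because `A^*` lies in `K + y (blowUp A)^*` for a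
minimal `y` of `A`. Allowing `x` in the Arf closure matters: the components of a minimal element of
`C` need not lie in the branches. -/
theorem mem_arfClosure_blowUp_iff (h : 1 ≤ mult A) {x : PowerSeries K} (hx : x ∈ arfClosure A)
    (hxo : x.order = mult A) {v : PowerSeries K} :
    v ∈ arfClosure (blowUp A) ↔ x * v ∈ arfClosure A := by
  have hx0 := ne_zero_of_order_eq_coe hxo
  constructor
  · intro hv
    have hA := isArf_arfClosure A
    have hn := mem_nonZeroDivisors_of_ne_zero hx0
    have hle : arfClosure (blowUp A) ≤ hA.divBy hx hn := by
      refine arfClosure_le (hA.isArf_divBy hx hn) (Algebra.adjoin_le ?_)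
      rintro z ⟨y, hy, -, hyo, hz⟩
      obtain ⟨e, rfl⟩ := exists_mul_eq_of_order_le (f := y) hx0 (by rw [hxo, hyo])
      have heD : e ∈ hA.divBy hx hn := le_arfClosure A hy
      have he : e.order = (0 : ℕ) := order_eq_of_mul_eq hxo (by simpa using hyo) rfl
      obtain ⟨e', he'⟩ := (isUnit_of_constantCoeff_ne_zero (order_eq_zero_iff.1 he)).exists_right_inv
      have he'D := (hA.isArf_divBy hx hn).mem_of_mul_eq_one heD he'
      have hez : e * z ∈ hA.divBy hx hn := by
        rw [hA.mem_divBy, ← mul_assoc]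
        exact le_arfClosure A hz
      have : z = e' * (e * z) := by linear_combination (- z) * he'
      rw [this]
      exact mul_mem he'D hez
    exact hle hv
  · intro hv
    obtain ⟨y, hy, hyo⟩ := exists_order_eq_mult h
    have hc := constantCoeff_eq_zero_of_order_eq_mult h hxo
    obtain ⟨e, heC, rfl⟩ := exists_mul_of_mem_arfClosure h hy hyo hx hc
    obtain ⟨w, hwC, hw⟩ := exists_mul_of_mem_arfClosure h hy hyo hv (by simp [hc])
    have he : e.order = (0 : ℕ) := order_eq_of_mul_eq hyo (by simpa using hxo) rfl
    obtain ⟨e', he'⟩ := (isUnit_of_constantCoeff_ne_zero (order_eq_zero_iff.1 he)).exists_right_inv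
    have he'C := (isArf_arfClosure (blowUp A)).mem_of_mul_eq_one heC he'
    have hw' : w = e * v := by
      rw [mul_assoc] at hw
      exact (mul_left_cancel₀ (ne_zero_of_order_eq_coe hyo) hw).symm
    have : v = e' * w := by rw [hw']; linear_combination (- v) * he'
    rw [this]
    exact mul_mem he'C hwC

/-! ### Multiplicity sequences -/

/-- The multiplicity sequence, indexed from `0`. -/
noncomputable def blowUpMult (A : Subalgebra K (PowerSeries K)) (j : ℕ) : ℕ :=
  mult (blowUp^[j] A)

theorem blowUpMult_zero : blowUpMult A 0 = mult A := rfl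

theorem blowUpMult_blowUp (j : ℕ) : blowUpMult (blowUp A) j = blowUpMult A (j + 1) := by
  simp [blowUpMult]

theorem one_le_blowUpMult (h : 1 ≤ mult A) (j : ℕ) : 1 ≤ blowUpMult A j := by
  induction j generalizing A with
  | zero => exact h
  | succ j ih => rw [← blowUpMult_blowUp]; exact ih (one_le_mult_blowUp h)

theorem sum_blowUpMult_succ (n : ℕ) :
    ∑ j ∈ Finset.range (n + 1), blowUpMult A j =
      mult A + ∑ j ∈ Finset.range n, blowUpMult (blowUp A) j := by
  simp only [blowUpMult_blowUp]
  rw [Finset.sum_range_succ', add_comm, blowUpMult_zero]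

theorem order_eq_sum_of_lt (h : 1 ≤ mult A) (n : ℕ) {f : PowerSeries K} (hf : f ∈ arfClosure A)
    (hlt : f.order < (∑ j ∈ Finset.range n, blowUpMult A j : ℕ)) :
    ∃ i < n, f.order = (∑ j ∈ Finset.range i, blowUpMult A j : ℕ) := by
  induction n generalizing A f with
  | zero => simp at hlt
  | succ n ih =>
    by_cases h0 : constantCoeff f = 0
    · obtain ⟨x, hx, hxo⟩ := exists_order_eq_mult h
      obtain ⟨z, hz, rfl⟩ := exists_mul_of_mem_arfClosure h hx hxo hf h0
      rw [order_mul, hxo, sum_blowUpMult_succ, Nat.cast_add] at hlt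
      obtain ⟨i, hi, hio⟩ := ih (one_le_mult_blowUp h) hz
        ((ENat.add_lt_add_iff_left (ENat.natCast_ne_top _)).1 hlt)
      refine ⟨i + 1, by omega, ?_⟩
      rw [order_mul, hxo, sum_blowUpMult_succ, hio, Nat.cast_add]
    · exact ⟨0, by omega, by simpa using order_eq_zero_iff.2 h0⟩

theorem exists_order_eq_of_sum_le (h : 1 ≤ mult A) (n : ℕ) (hn : ∀ j, n ≤ j → blowUpMult A j = 1)
    (d : ℕ) (hd : ∑ j ∈ Finset.range n, blowUpMult A j ≤ d) :
    ∃ f ∈ arfClosure A, f.order = (d : ℕ∞) := by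
  obtain ⟨x, hx, hxo⟩ := exists_order_eq_mult h
  induction n generalizing A d x with
  | zero =>
    have h1 : mult A = 1 := hn 0 le_rfl
    refine ⟨x ^ d, pow_mem (le_arfClosure A hx) d, ?_⟩
    rw [order_pow, hxo, h1]
    simp
  | succ n ih =>
    rw [sum_blowUpMult_succ] at hd
    obtain ⟨y, hy, hyo⟩ := exists_order_eq_mult (one_le_mult_blowUp h)
    obtain ⟨f, hf, hfo⟩ := ih (one_le_mult_blowUp h)
      (fun j hj => by rw [blowUpMult_blowUp]; exact hn _ (by omega)) (d - mult A) (by omega) y hy hyo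
    refine ⟨x * f, (mem_arfClosure_blowUp_iff h (le_arfClosure A hx) hxo).1 hf, ?_⟩
    rw [order_mul, hxo, hfo, ← Nat.cast_add]
    congr 1
    omega

theorem le_iterate_blowUp (h : 1 ≤ mult A) (j : ℕ) : A ≤ blowUp^[j] A := by
  induction j generalizing A with
  | zero => exact le_rfl
  | succ j ih => exact (le_blowUp h).trans (ih (one_le_mult_blowUp h))

theorem antitone_blowUpMult (h : 1 ≤ mult A) : Antitone (blowUpMult A) := by
  refine antitone_nat_of_succ_le fun j => ?_
  simp only [blowUpMult, Function.iterate_succ_apply']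
  exact mult_blowUp_le (one_le_blowUpMult h j)

/-- Descent: dividing by a minimal element lowers the order by `m` and passes to the blow-up, whose
multiplicities are again all `m`. -/
theorem dvd_order_of_blowUpMult_eq (h : 1 ≤ mult A) {m : ℕ} (hm : ∀ j, blowUpMult A j = m)
    {f : PowerSeries K} (hf : f ∈ A) {d : ℕ} (hd : f.order = d) : m ∣ d := by
  induction d using Nat.strong_induction_on generalizing A f with
  | _ d ih =>
    rcases Nat.eq_zero_or_pos d with rfl | hpos
    · exact dvd_zero m
    obtain ⟨x, hx, hxo⟩ := exists_order_eq_mult h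
    have h0 : constantCoeff f = 0 := by
      rw [← one_le_order_iff_constCoeff_eq_zero, hd]
      exact_mod_cast hpos
    obtain ⟨z, hz, rfl⟩ := exists_mul_of_constantCoeff_eq_zero h hx hxo hf h0
    have hle : mult A ≤ d := by
      have := mult_le_order hf h0
      rw [hd] at this
      exact_mod_cast this
    have hzo : z.order = (d - mult A : ℕ) :=
      order_eq_of_mul_eq hxo (by rw [hd]; congr 1; omega) rfl
    have := ih (d - mult A) (by omega) (one_le_mult_blowUp h)
      (fun j => by rw [blowUpMult_blowUp, hm]) hz hzo
    have hmA : mult A = m := hm 0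
    rw [hmA] at this hle
    have h2 := Nat.dvd_add this (dvd_refl m)
    rwa [Nat.sub_add_cancel hle] at h2

/-- The multiplicities decrease to a stable value. It divides all orders in `A`, in particular those
of `b` and `b * X`, which are consecutive. -/
theorem exists_blowUpMult_eq_one (h : 1 ≤ mult A) {a b : PowerSeries K} (ha : a ∈ A) (hb : b ∈ A)
    (hb0 : b ≠ 0) (hab : b * X = a) : ∃ n, ∀ j, n ≤ j → blowUpMult A j = 1 := by
  obtain ⟨n, hn⟩ : ∃ n, ∀ j, n ≤ j → blowUpMult A j = blowUpMult A n := by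
    obtain ⟨n, hn⟩ := Nat.sInf_mem (Set.range_nonempty (blowUpMult A))
    refine ⟨n, fun j hj => le_antisymm (antitone_blowUpMult h hj) ?_⟩
    rw [hn]
    exact Nat.sInf_le ⟨j, rfl⟩
  have hle := le_iterate_blowUp h n
  have hdvd : ∀ f ∈ A, ∀ d : ℕ, f.order = d → blowUpMult A n ∣ d := fun f hf d hd =>
    dvd_order_of_blowUpMult_eq (A := blowUp^[n] A) (one_le_blowUpMult h n)
      (fun j => by
        rw [blowUpMult, ← Function.iterate_add_apply]
        exact hn (j + n) (by omega)) (hle hf) hd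
  have hbo := (coe_toNat_order hb0).symm
  have hao : a.order = (b.order.toNat + 1 : ℕ) := by
    rw [← hab, order_mul, order_X, Nat.cast_add, ← hbo, Nat.cast_one]
  have h1 := (Nat.dvd_add_right (hdvd b hb _ hbo)).1 (hdvd a ha _ hao)
  exact ⟨n, fun j hj => (hn j hj).trans (Nat.dvd_one.1 h1)⟩

end Branch

/-! ### Conductors of complete rings -/

section Complete

open PowerSeries

theorem eq_zero_of_forall_eq_mul {y : PowerSeries K} (hy : constantCoeff y = 0)
    {r : ℕ → PowerSeries K} (hr : ∀ n, r n = y * r (n + 1)) : r 0 = 0 := by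
  have h : ∀ n : ℕ, ∀ m, (n : ℕ∞) ≤ (r m).order := by
    intro n
    induction n with
    | zero => simp
    | succ n ih =>
      intro m
      rw [hr, order_mul, Nat.cast_add, add_comm, Nat.cast_one]
      exact add_le_add (one_le_order_iff_constCoeff_eq_zero.2 hy) (ih _)
  rw [← order_eq_top, ENat.eq_top_iff_forall_ge]
  exact fun n => h n 0

/-- Leading coefficients are cancelled one at a time. -/
theorem exists_le_order_sub_sum {c : ℕ} {Y : ℕ → PowerSeries K}
    (hY : ∀ d, c ≤ d → (Y d).order = d) {f : PowerSeries K} (hf : c ≤ f.order) (m : ℕ) :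
    ∃ a : ℕ → K, ((c + m : ℕ) : ℕ∞) ≤ (f - ∑ i ∈ Finset.range m, C (a i) * Y (c + i)).order := by
  induction m with
  | zero => exact ⟨0, by simpa using hf⟩
  | succ m ih =>
    obtain ⟨a, ha⟩ := ih
    set g := f - ∑ i ∈ Finset.range m, C (a i) * Y (c + i) with hg
    have hYm := hY (c + m) (by omega)
    have hne : coeff (c + m) (Y (c + m)) ≠ 0 := (order_eq_nat.1 hYm).1
    refine ⟨fun i => if i = m then coeff (c + m) g / coeff (c + m) (Y (c + m)) else a i, ?_⟩
    have : f - ∑ i ∈ Finset.range (m + 1),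
        C (if i = m then coeff (c + m) g / coeff (c + m) (Y (c + m)) else a i) * Y (c + i) =
        g - C (coeff (c + m) g / coeff (c + m) (Y (c + m))) * Y (c + m) := by
      rw [Finset.sum_range_succ, if_pos rfl, hg, sub_sub]
      congr 2
      refine Finset.sum_congr rfl fun i hi => ?_
      rw [if_neg (Finset.mem_range.1 hi).ne]
    rw [this]
    refine nat_le_order _ _ fun i hi => ?_
    rcases Nat.lt_succ_iff_lt_or_eq.1 (show i < (c + m) + 1 by omega) with hlt | rfl
    · have h1 : coeff i g = 0 := coeff_of_lt_order _ (lt_of_lt_of_le (by exact_mod_cast hlt) ha)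
      have h2 : coeff i (Y (c + m)) = 0 :=
        coeff_of_lt_order _ (by rw [hYm]; exact_mod_cast hlt)
      simp [h1, h2]
    · simp [hne]

/-- A subring of `K[[t]]` that is closed under substitution in power series and has elements of
every order `≥ c` contains `t ^ c K[[t]]`. -/
theorem mem_of_le_order {A : Subalgebra K (PowerSeries K)}
    (hA : ∀ y ∈ A, constantCoeff y = 0 → ∀ P : PowerSeries K, P.subst y ∈ A) {c : ℕ}
    (hc : 1 ≤ c) (h : ∀ d, c ≤ d → ∃ f ∈ A, f.order = (d : ℕ∞)) {f : PowerSeries K}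
    (hf : c ≤ f.order) : f ∈ A := by
  choose! Y hYA hY using h
  have hy0 : constantCoeff (Y c) = 0 := by
    rw [← one_le_order_iff_constCoeff_eq_zero, hY c le_rfl]
    exact_mod_cast hc
  have hs : HasSubst (Y c) := HasSubst.of_constantCoeff_zero' hy0
  -- With `y = Y c`, cancelling the `c` coefficients in degrees `c, …, 2c - 1` leaves a multiple of
  -- `y` whose cofactor again has order at least `c`.
  have step : ∀ f : PowerSeries K, c ≤ f.order → ∃ a : ℕ → K, ∃ g : PowerSeries K,
      c ≤ g.order ∧ f = ∑ i ∈ Finset.range c, C (a i) * Y (c + i) + Y c * g := by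
    intro f hf
    obtain ⟨a, ha⟩ := exists_le_order_sub_sum hY hf c
    obtain ⟨g, hg⟩ := exists_mul_eq_of_order_le (ne_zero_of_order_eq_coe (hY c le_rfl))
      (le_trans (by rw [hY c le_rfl]; exact_mod_cast Nat.le_add_right c c) ha)
    refine ⟨a, g, ?_, by rw [← hg]; ring⟩
    rw [hg, order_mul, hY c le_rfl, Nat.cast_add] at ha
    exact (ENat.addLECancellable_natCast c).add_le_add_iff_left.1 ha
  choose! a nxt hnxt hstep using step
  let F : ℕ → PowerSeries K := fun n => nxt^[n] f
  have hF : ∀ n, c ≤ (F n).order := by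
    intro n
    induction n with
    | zero => exact hf
    | succ n ih =>
      simp only [F, Function.iterate_succ_apply']
      exact hnxt _ ih
  -- Collecting the coefficients of each `Y (c + i)` over all rounds gives a power series in `y`. So
  -- `f` is a combination of finitely many `Y (c + i)` over `K[[y]]`, and substitution is the only
  -- limit needed.
  let S : ℕ → ℕ → PowerSeries K := fun n i => (mk fun k => a (F (n + k)) i).subst (Y c)
  have hS : ∀ n i, S n i = C (a (F n) i) + Y c * S (n + 1) i := by
    intro n i
    have : (mk fun k => a (F (n + k)) i) =
        (mk fun k => a (F (n + 1 + k)) i) * X + C (a (F n) i) := by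
      rw [eq_shift_mul_X_add_const (mk fun k => a (F (n + k)) i)]
      simp [add_assoc, add_comm 1]
    simp only [S]
    rw [this, subst_add hs, subst_mul hs, subst_X hs, subst_C, add_comm, mul_comm]
    rfl
  have hr := eq_zero_of_forall_eq_mul hy0
    (r := fun n => F n - ∑ i ∈ Finset.range c, S n i * Y (c + i)) (fun n => by
      have h1 : F (n + 1) = nxt (F n) := by simp only [F, Function.iterate_succ_apply']
      conv_lhs => rw [hstep (F n) (hF n)]
      rw [h1, mul_sub, Finset.mul_sum]
      have : ∑ i ∈ Finset.range c, S n i * Y (c + i) =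
          ∑ i ∈ Finset.range c, C (a (F n) i) * Y (c + i) +
            ∑ i ∈ Finset.range c, Y c * (S (n + 1) i * Y (c + i)) := by
        rw [← Finset.sum_add_distrib]
        refine Finset.sum_congr rfl fun i _ => ?_
        rw [hS n i]
        ring
      rw [this]
      ring)
  have : f = ∑ i ∈ Finset.range c, S 0 i * Y (c + i) := sub_eq_zero.1 hr
  rw [this]
  exact A.sum_mem fun i _ =>
    A.mul_mem (hA _ (hYA c le_rfl) hy0 _) (hYA _ (by omega))

theorem exists_forall_exists_order_eq {A : Subalgebra K (PowerSeries K)} {a b : PowerSeries K}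
    (ha : a ∈ A) (hb : b ∈ A) (hb0 : b ≠ 0) (hab : b * X = a) :
    ∃ c : ℕ, ∀ d, c ≤ d → ∃ f ∈ A, f.order = (d : ℕ∞) := by
  set s := b.order.toNat with hs
  have hbo : b.order = s := (coe_toNat_order hb0).symm
  have hao : a.order = (s + 1 : ℕ) := by
    rw [← hab, order_mul, order_X, Nat.cast_add, ← hbo, Nat.cast_one]
  -- Orders `s` and `s + 1` occur. For `d = q s + r` with `r < s ≤ q`, write `d = (q - r) s + r (s +
  -- 1)`.
  refine ⟨s * s, fun d hd => ?_⟩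
  rcases Nat.eq_zero_or_pos s with h0 | hpos
  · exact ⟨a ^ d, pow_mem ha d, by rw [order_pow, hao, h0]; simp⟩
  · have hq : s ≤ d / s := (Nat.le_div_iff_mul_le hpos).2 hd
    have hr : d % s < s := Nat.mod_lt d hpos
    refine ⟨b ^ (d / s - d % s) * a ^ (d % s), mul_mem (pow_mem hb _) (pow_mem ha _), ?_⟩
    rw [order_mul, order_pow, order_pow, hao, hbo]
    have : (d / s - d % s) * s + (d % s) * (s + 1) = d := by
      obtain ⟨k, hk⟩ := Nat.exists_eq_add_of_le (hr.le.trans hq)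
      have := Nat.div_add_mod d s
      rw [hk] at this ⊢
      rw [Nat.add_sub_cancel_left]
      nlinarith
    simp only [nsmul_eq_mul]
    exact_mod_cast this

end Complete

/-- The conductor ideal of `A ⊆ K[[t]] × K[[u]]` contains `(t ^ c, u ^ c)` for some `c`. -/
def HasConductor (A : Subalgebra K (PowerSeries K × PowerSeries K)) : Prop :=
  ∃ c : ℕ, ∀ f g : PowerSeries K, c ≤ f.order → c ≤ g.order → (f, g) ∈ A

theorem HasConductor.mono {A C : Subalgebra K (PowerSeries K × PowerSeries K)}
    (hA : HasConductor A) (h : A ≤ C) : HasConductor C := by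
  obtain ⟨c, hc⟩ := hA
  exact ⟨c, fun f g hf hg => h (hc f g hf hg)⟩

/-! ### Images of substitution maps: closure under substitution and conductors -/

section Subst

variable {n : ℕ} {a : Fin n → PowerSeries K}

theorem constantCoeff_substAlgHom (ha : MvPowerSeries.HasSubst a)
    (ha0 : ∀ i, PowerSeries.constantCoeff (a i) = 0) (F : MvPowerSeries (Fin n) K) :
    PowerSeries.constantCoeff (MvPowerSeries.substAlgHom ha F : PowerSeries K) =
      MvPowerSeries.constantCoeff F := by
  have h1 : F = (F - MvPowerSeries.C (MvPowerSeries.constantCoeff F)) +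
      algebraMap K _ (MvPowerSeries.constantCoeff F) := by
    simp [MvPowerSeries.algebraMap_apply]
  conv_lhs => rw [h1]
  rw [map_add, AlgHom.commutes, map_add, MvPowerSeries.substAlgHom_apply]
  have h2 := MvPowerSeries.constantCoeff_subst_eq_zero ha ha0
    (f := F - MvPowerSeries.C (MvPowerSeries.constantCoeff F)) (by simp)
  have h3 : PowerSeries.constantCoeff (MvPowerSeries.subst a
    (F - MvPowerSeries.C (MvPowerSeries.constantCoeff F)) : PowerSeries K) = 0 := h2
  rw [h3]
  simp

theorem subst_mem_range_substAlgHom (ha : MvPowerSeries.HasSubst a)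
    (ha0 : ∀ i, PowerSeries.constantCoeff (a i) = 0) {y : PowerSeries K}
    (hy : y ∈ (MvPowerSeries.substAlgHom ha :
      MvPowerSeries (Fin n) K →ₐ[K] PowerSeries K).range)
    (hy0 : PowerSeries.constantCoeff y = 0) (P : PowerSeries K) :
    P.subst y ∈ (MvPowerSeries.substAlgHom ha :
      MvPowerSeries (Fin n) K →ₐ[K] PowerSeries K).range := by
  obtain ⟨G, rfl⟩ := hy
  have hG : PowerSeries.HasSubst G := by
    apply PowerSeries.HasSubst.of_constantCoeff_zero
    rw [← constantCoeff_substAlgHom ha ha0 G]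
    exact hy0
  refine ⟨P.subst G, ?_⟩
  have := MvPowerSeries.subst_comp_subst_apply hG.const ha P
  rw [← MvPowerSeries.substAlgHom_apply ha] at this
  exact this.trans (by simp [PowerSeries.subst_def, MvPowerSeries.substAlgHom_apply ha])

theorem exists_forall_mem_of_le_order (ha : MvPowerSeries.HasSubst a)
    (ha0 : ∀ i, PowerSeries.constantCoeff (a i) = 0)
    (hf : ∀ f : PowerSeries K, ∃ p ∈ (MvPowerSeries.substAlgHom ha :
        MvPowerSeries (Fin n) K →ₐ[K] PowerSeries K).range,
      ∃ q ∈ (MvPowerSeries.substAlgHom ha :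
        MvPowerSeries (Fin n) K →ₐ[K] PowerSeries K).range, q ≠ 0 ∧ q * f = p) :
    ∃ c : ℕ, ∀ f : PowerSeries K, c ≤ f.order → f ∈ (MvPowerSeries.substAlgHom ha :
      MvPowerSeries (Fin n) K →ₐ[K] PowerSeries K).range := by
  obtain ⟨p, hp, q, hq, hq0, hqp⟩ := hf PowerSeries.X
  obtain ⟨c, hc⟩ := exists_forall_exists_order_eq hp hq hq0 hqp
  refine ⟨c + 1, fun f hf => mem_of_le_order
    (fun y hy hy0 P => subst_mem_range_substAlgHom ha ha0 hy hy0 P) (by omega)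
    (fun d hd => hc d (by omega)) hf⟩

end Subst

/-! ### The curve ring: its conductor ideal and its change under steps -/

namespace Parametrization

variable {n : ℕ} (P : Parametrization K n)

theorem mem_curveRing {z : PowerSeries K × PowerSeries K} :
    z ∈ P.curveRing ↔ ∃ F, P.hom₁ F = z.1 ∧ P.hom₂ F = z.2 := by
  simp [curveRing, Prod.ext_iff]

theorem hom₁_X (i : Fin n) : P.hom₁ (MvPowerSeries.X i) = P.φ i :=
  MvPowerSeries.substAlgHom_X P.hasSubst_φ i

theorem hom₂_X (i : Fin n) : P.hom₂ (MvPowerSeries.X i) = P.ψ i :=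
  MvPowerSeries.substAlgHom_X P.hasSubst_ψ i

theorem constantCoeff_hom₁ (F : MvPowerSeries (Fin n) K) :
    PowerSeries.constantCoeff (P.hom₁ F) = MvPowerSeries.constantCoeff F :=
  constantCoeff_substAlgHom P.hasSubst_φ P.φ_zero F

theorem IsAlgebroidCurve.hasConductor {P : Parametrization K n} (hP : P.IsAlgebroidCurve) :
    HasConductor P.curveRing := by
  obtain ⟨c₁, h₁⟩ := exists_forall_mem_of_le_order P.hasSubst_φ P.φ_zero hP.frac₁
  obtain ⟨c₂, h₂⟩ := exists_forall_mem_of_le_order P.hasSubst_ψ P.ψ_zero hP.frac₂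
  obtain ⟨F, hF, hF2⟩ := SetLike.not_le_iff_exists.1 hP.not_le₁₂
  obtain ⟨G, hG, hG1⟩ := SetLike.not_le_iff_exists.1 hP.not_le₂₁
  rw [RingHom.mem_ker] at hF hF2 hG hG1
  have key : ∀ (c : ℕ) (y f : PowerSeries K), y ≠ 0 → (c + y.order.toNat : ℕ) ≤ f.order →
      ∃ g : PowerSeries K, c ≤ g.order ∧ f = y * g := by
    intro c y f hy hf
    have hyo := PowerSeries.coe_toNat_order hy
    obtain ⟨g, rfl⟩ := exists_mul_eq_of_order_le (f := f) hy
      (le_trans (by rw [← hyo]; exact_mod_cast Nat.le_add_left _ _) hf)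
    refine ⟨g, ?_, rfl⟩
    rw [PowerSeries.order_mul, add_comm, Nat.cast_add, ← hyo] at hf
    exact (ENat.addLECancellable_natCast _).add_le_add_iff_left.1 hf
  refine ⟨max (c₁ + (P.hom₁ G).order.toNat) (c₂ + (P.hom₂ F).order.toNat), fun f g hf hg => ?_⟩
  obtain ⟨f', hf', hff⟩ := key c₁ _ f hG1 (le_trans (by exact_mod_cast le_max_left _ _) hf)
  obtain ⟨g', hg', hgg⟩ := key c₂ _ g hF2 (le_trans (by exact_mod_cast le_max_right _ _) hg)
  obtain ⟨U, hU⟩ := h₁ f' hf'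
  obtain ⟨V, hV⟩ := h₂ g' hg'
  have hU' : P.hom₁ U = f' := hU
  have hV' : P.hom₂ V = g' := hV
  have hF' : P.hom₁ F = 0 := hF
  have hG' : P.hom₂ G = 0 := hG
  -- `F` vanishes on the first branch only and `G` on the second only, so each term adjusts one
  -- component without changing the other.
  refine P.mem_curveRing.2 ⟨G * U + F * V, ?_, ?_⟩
  · rw [map_add, map_mul, map_mul, hF', hU', hff]
    simp
  · rw [map_add, map_mul, map_mul, hG', hV', hgg]
    simp

/-- The new generators are polynomials without constant term in the old ones, so a power series in
the new ones is, by composition, one in the old ones. -/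
theorem Step.curveRing_le {P Q : Parametrization K n} (h : Step P Q) :
    Q.curveRing ≤ P.curveRing := by
  classical
  obtain ⟨p, q, hpq, -, ⟨a, b, r, s, hr, hs, hφ, hψ⟩, -, hj⟩ := h
  let G : Fin n → MvPowerSeries (Fin n) K := fun i =>
    if i = p then a • MvPowerSeries.X p ^ r + b • MvPowerSeries.X q ^ s else MvPowerSeries.X i
  have hG1 : ∀ i, P.hom₁ (G i) = Q.φ i := by
    intro i
    by_cases hi : i = p
    · subst hi
      simp [G, hφ, hom₁_X]
    · simp [G, hi, (hj i hi).1, hom₁_X]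
  have hG2 : ∀ i, P.hom₂ (G i) = Q.ψ i := by
    intro i
    by_cases hi : i = p
    · subst hi
      simp [G, hψ, hom₂_X]
    · simp [G, hi, (hj i hi).2, hom₂_X]
  have hG : MvPowerSeries.HasSubst G := by
    apply MvPowerSeries.hasSubst_of_constantCoeff_zero
    intro i
    rw [← P.constantCoeff_hom₁, hG1, Q.φ_zero]
  intro z hz
  obtain ⟨F, h1, h2⟩ := Q.mem_curveRing.1 hz
  refine P.mem_curveRing.2 ⟨F.subst G, ?_, ?_⟩
  · rw [← h1, hom₁, hom₁, MvPowerSeries.substAlgHom_apply, MvPowerSeries.substAlgHom_apply,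
      MvPowerSeries.subst_comp_subst_apply hG P.hasSubst_φ]
    congr 1
    funext i
    rw [← hG1 i, hom₁, MvPowerSeries.substAlgHom_apply]
  · rw [← h2, hom₂, hom₂, MvPowerSeries.substAlgHom_apply, MvPowerSeries.substAlgHom_apply,
      MvPowerSeries.subst_comp_subst_apply hG P.hasSubst_ψ]
    congr 1
    funext i
    rw [← hG2 i, hom₂, MvPowerSeries.substAlgHom_apply]

theorem curveRing_le_of_reflTransGen {P Q : Parametrization K n}
    (h : Relation.ReflTransGen Step P Q) : Q.curveRing ≤ P.curveRing := by
  induction h with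
  | refl => exact le_rfl
  | tail _ h ih => exact h.curveRing_le.trans ih

end Parametrization

open PowerSeries

/-! ### Value semigroups -/

section ValueSemigroup

theorem inf_mem_valueSemigroup {C : Subalgebra K (PowerSeries K × PowerSeries K)} {a b a' b' : ℕ}
    (h : (a, b') ∈ valueSemigroup C) (h' : (a', b) ∈ valueSemigroup C) (ha : a < a')
    (hb : b < b') : (a, b) ∈ valueSemigroup C := by
  obtain ⟨f, hf, hf1, hf2⟩ := h
  obtain ⟨g, hg, hg1, hg2⟩ := h'
  dsimp only at hf1 hf2 hg1 hg2
  have h1 : f.1.order < g.1.order := by rw [hf1, hg1]; exact_mod_cast ha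
  have h2 : g.2.order < f.2.order := by rw [hf2, hg2]; exact_mod_cast hb
  refine ⟨f + g, C.add_mem hf hg, ?_, ?_⟩
  · rw [Prod.fst_add, order_add_of_order_ne _ _ h1.ne, inf_eq_left.2 h1.le, hf1]
  · rw [Prod.snd_add, order_add_of_order_ne _ _ h2.ne', inf_eq_right.2 h2.le, hg2]

/-- In the mixed cases one bound supplies `(β₁, large)` and the other `(large, β₂)`; the sum of such
elements has value `(β₁, β₂)`. -/
theorem inf_mem_conductors {C : Subalgebra K (PowerSeries K × PowerSeries K)} {δ ε : ℕ × ℕ}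
    (hδ : ∀ β, δ ≤ β → β ∈ valueSemigroup C) (hε : ∀ β, ε ≤ β → β ∈ valueSemigroup C) :
    ∀ β, δ ⊓ ε ≤ β → β ∈ valueSemigroup C := by
  rintro ⟨β₁, β₂⟩ hβ
  obtain ⟨d1, d2⟩ := δ
  obtain ⟨e1, e2⟩ := ε
  simp only [Prod.le_def, Prod.forall, Prod.mk_inf_mk] at *
  rcases le_total d1 e1 with h1 | h1 <;> rcases le_total d2 e2 with h2 | h2
  · exact hδ _ _ (by simpa [h1, h2] using hβ)
  · simp only [h1, h2, inf_of_le_left, inf_of_le_right] at hβ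
    exact inf_mem_valueSemigroup (hδ β₁ (β₂ + d2 + 1) ⟨hβ.1, by omega⟩)
      (hε (β₁ + e1 + 1) β₂ ⟨by omega, hβ.2⟩) (by omega) (by omega)
  · simp only [h1, h2, inf_of_le_left, inf_of_le_right] at hβ
    exact inf_mem_valueSemigroup (hε β₁ (β₂ + e2 + 1) ⟨hβ.1, by omega⟩)
      (hδ (β₁ + d1 + 1) β₂ ⟨by omega, hβ.2⟩) (by omega) (by omega)
  · exact hε _ _ (by simpa [h1, h2] using hβ)

theorem exists_isConductor {C : Subalgebra K (PowerSeries K × PowerSeries K)} {δ : ℕ × ℕ}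
    (hδ : ∀ β, δ ≤ β → β ∈ valueSemigroup C) : ∃ c, IsConductor (valueSemigroup C) c := by
  let S : Set (ℕ × ℕ) := {δ | ∀ β, δ ≤ β → β ∈ valueSemigroup C}
  have h1 : (Prod.fst '' S).Nonempty := ⟨_, δ, hδ, rfl⟩
  have h2 : (Prod.snd '' S).Nonempty := ⟨_, δ, hδ, rfl⟩
  obtain ⟨p, hp, hp1⟩ := Nat.sInf_mem h1
  obtain ⟨q, hq, hq2⟩ := Nat.sInf_mem h2
  refine ⟨p ⊓ q, inf_mem_conductors hp hq, fun ε hε => ⟨?_, ?_⟩⟩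
  · exact inf_le_left.trans (hp1 ▸ Nat.sInf_le ⟨ε, hε, rfl⟩)
  · exact inf_le_right.trans (hq2 ▸ Nat.sInf_le ⟨ε, hε, rfl⟩)

end ValueSemigroup

/-! ### Rings with two branches -/

section TwoBranches

variable {C : Subalgebra K (PowerSeries K × PowerSeries K)}

theorem mem_nonZeroDivisors_prod_iff {x : PowerSeries K × PowerSeries K} :
    x ∈ nonZeroDivisors (PowerSeries K × PowerSeries K) ↔ x.1 ≠ 0 ∧ x.2 ≠ 0 := by
  rw [mem_nonZeroDivisors_iff_right]
  constructor
  · intro h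
    constructor
    · intro h0
      have := h (1, 0) (by ext1 <;> simp [h0])
      simp at this
    · intro h0
      have := h (0, 1) (by ext1 <;> simp [h0])
      simp at this
  · rintro ⟨h1, h2⟩ y hy
    rw [Prod.ext_iff] at hy
    exact Prod.ext ((mul_eq_zero.1 hy.1).resolve_right h1) ((mul_eq_zero.1 hy.2).resolve_right h2)

theorem isArf_prod {A B : Subalgebra K (PowerSeries K)} (hA : IsArf A) (hB : IsArf B) :
    IsArf (A.prod B) := by
  rintro x ⟨hx1, hx2⟩ hx v w ⟨hv1, hv2⟩ ⟨hw1, hw2⟩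
  rw [mem_nonZeroDivisors_prod_iff] at hx
  exact ⟨hA _ hx1 (mem_nonZeroDivisors_of_ne_zero hx.1) _ _ hv1 hw1,
    hB _ hx2 (mem_nonZeroDivisors_of_ne_zero hx.2) _ _ hv2 hw2⟩

/-- The ring `C ⊆ K[[t]] × K[[u]]` is local: both components of its elements have the same constant
coefficient. -/
def IsGlued (C : Subalgebra K (PowerSeries K × PowerSeries K)) : Prop :=
  ∀ z ∈ C, constantCoeff z.1 = constantCoeff z.2

theorem le_order_pow {f : PowerSeries K} (hf : constantCoeff f = 0) (n : ℕ) :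
    (n : ℕ∞) ≤ (f ^ n).order :=
  le_order_pow_of_constantCoeff_eq_zero n hf

/-- Some `e ∈ C` has constant coefficients 1 and 0. High powers are corrected by the conductor:
first `e ^ c` loses its second component, then `1 - (1 - e₁ ^ c) ^ c` becomes 1. -/
theorem one_zero_mem (hC : HasConductor C) (h : ¬ IsGlued C) :
    ((1, 0) : PowerSeries K × PowerSeries K) ∈ C := by
  obtain ⟨c, hc⟩ := hC
  simp only [IsGlued, not_forall] at h
  obtain ⟨z, hz, hne⟩ := h
  set k := constantCoeff z.1 - constantCoeff z.2 with hk
  have hk0 : k ≠ 0 := sub_ne_zero.2 hne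
  set e := k⁻¹ • (z - algebraMap K _ (constantCoeff z.2)) with he
  have heC : e ∈ C := C.smul_mem (C.sub_mem hz (C.algebraMap_mem _)) _
  have he1 : constantCoeff e.1 = 1 := by
    simp [he, ← hk, hk0]
  have he2 : constantCoeff e.2 = 0 := by
    simp [he]
  have h1 : ((e.1 ^ c, 0) : PowerSeries K × PowerSeries K) ∈ C := by
    have := C.sub_mem (C.pow_mem heC c) (hc 0 (e.2 ^ c) (by simp) (le_order_pow he2 c))
    convert this using 1
    ext1 <;> simp
  have h2 := C.sub_mem C.one_mem (C.pow_mem (C.sub_mem C.one_mem h1) c)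
  have h3 := hc ((1 - e.1 ^ c) ^ c) 0 (le_order_pow (by simp [he1]) c) (by simp)
  convert C.add_mem h2 h3 using 1
  ext1 <;> simp

theorem zero_one_mem (hC : HasConductor C) (h : ¬ IsGlued C) :
    ((0, 1) : PowerSeries K × PowerSeries K) ∈ C := by
  convert C.sub_mem C.one_mem (one_zero_mem hC h) using 1
  ext1 <;> simp

/-- In the blow-up, which need not be local, an element may be a unit in one component only. The
idempotent repairs the other component, so that the inverse lies in the Arf ring. -/
theorem exists_isUnit_fst (hC : HasConductor C) {e : PowerSeries K × PowerSeries K} (he : e ∈ C)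
    (h : constantCoeff e.1 ≠ 0) : ∃ e' ∈ C, e'.1 = e.1 ∧ constantCoeff e'.2 ≠ 0 := by
  by_cases h2 : constantCoeff e.2 = 0
  · have hg : ¬ IsGlued C := fun hg => h ((hg e he).trans h2)
    exact ⟨e + (0, 1), C.add_mem he (zero_one_mem hC hg), by simp, by simp [h2]⟩
  · exact ⟨e, he, rfl, h2⟩

theorem exists_isUnit_snd (hC : HasConductor C) {e : PowerSeries K × PowerSeries K} (he : e ∈ C)
    (h : constantCoeff e.2 ≠ 0) : ∃ e' ∈ C, e'.2 = e.2 ∧ constantCoeff e'.1 ≠ 0 := by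
  by_cases h1 : constantCoeff e.1 = 0
  · have hg : ¬ IsGlued C := fun hg => h ((hg e he).symm.trans h1)
    exact ⟨e + (1, 0), C.add_mem he (one_zero_mem hC hg), by simp, by simp [h1]⟩
  · exact ⟨e, he, rfl, h1⟩

theorem isUnit_prod {e : PowerSeries K × PowerSeries K} (h1 : constantCoeff e.1 ≠ 0)
    (h2 : constantCoeff e.2 ≠ 0) : IsUnit e :=
  Prod.isUnit_iff.2 ⟨isUnit_of_constantCoeff_ne_zero h1, isUnit_of_constantCoeff_ne_zero h2⟩

/-- `C` is an Arf ring whose projections lie between `A`, `B` and their Arf closures. -/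
structure IsArfOver (A B : Subalgebra K (PowerSeries K))
    (C : Subalgebra K (PowerSeries K × PowerSeries K)) : Prop where
  isArf : IsArf C
  hasConductor : HasConductor C
  one_le_mult_fst : 1 ≤ mult A
  one_le_mult_snd : 1 ≤ mult B
  exists_fst : ∀ f ∈ A, ∃ z ∈ C, z.1 = f
  exists_snd : ∀ g ∈ B, ∃ z ∈ C, z.2 = g
  fst_mem : ∀ z ∈ C, z.1 ∈ arfClosure A
  snd_mem : ∀ z ∈ C, z.2 ∈ arfClosure B

/-- The blow-up of `C`, where `A` and `B` are rings with the multiplicities of the two branches. -/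
noncomputable def blowUp₂ (A B : Subalgebra K (PowerSeries K))
    (C : Subalgebra K (PowerSeries K × PowerSeries K)) :
    Subalgebra K (PowerSeries K × PowerSeries K) :=
  Algebra.adjoin K {z | ∃ x ∈ C, x.1.order = mult A ∧ x.2.order = mult B ∧ x * z ∈ C}

namespace IsArfOver

variable {A B : Subalgebra K (PowerSeries K)} {x z : PowerSeries K × PowerSeries K}

/-- Lifts of minimal elements of the two branches are nonunits in both components. If neither is
minimal in both, their sum is, since no leading terms cancel. -/
theorem exists_min (h : IsArfOver A B C) (hg : IsGlued C) :
    ∃ x ∈ C, x.1.order = mult A ∧ x.2.order = mult B := by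
  obtain ⟨f, hf, hfo⟩ := exists_order_eq_mult h.one_le_mult_fst
  obtain ⟨g, hg', hgo⟩ := exists_order_eq_mult h.one_le_mult_snd
  obtain ⟨y, hy, rfl⟩ := h.exists_fst f hf
  obtain ⟨w, hw, rfl⟩ := h.exists_snd g hg'
  have hy0 := constantCoeff_eq_zero_of_order_eq_mult h.one_le_mult_fst hfo
  have hw0 := constantCoeff_eq_zero_of_order_eq_mult h.one_le_mult_snd hgo
  have hy2 := mult_le_order_of_mem_arfClosure h.one_le_mult_snd (h.snd_mem y hy)
    ((hg y hy).symm.trans hy0)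
  have hw1 := mult_le_order_of_mem_arfClosure h.one_le_mult_fst (h.fst_mem w hw)
    ((hg w hw).trans hw0)
  rcases hy2.eq_or_lt with hy2 | hy2
  · exact ⟨y, hy, hfo, hy2.symm⟩
  rcases hw1.eq_or_lt with hw1 | hw1
  · exact ⟨w, hw, hw1.symm, hgo⟩
  refine ⟨y + w, C.add_mem hy hw, ?_, ?_⟩
  · rw [← hfo] at hw1
    rw [Prod.fst_add, order_add_of_order_ne _ _ hw1.ne, inf_eq_left.2 hw1.le, hfo]
  · rw [← hgo] at hy2
    rw [Prod.snd_add, order_add_of_order_ne _ _ hy2.ne', inf_eq_right.2 hy2.le, hgo]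

theorem nonZeroDivisor (hx1 : x.1.order = mult A) (hx2 : x.2.order = mult B) :
    x ∈ nonZeroDivisors (PowerSeries K × PowerSeries K) :=
  mem_nonZeroDivisors_prod_iff.2 ⟨ne_zero_of_order_eq_coe hx1, ne_zero_of_order_eq_coe hx2⟩

theorem blowUp₂_eq (h : IsArfOver A B C) (hx : x ∈ C) (hx1 : x.1.order = mult A)
    (hx2 : x.2.order = mult B) :
    blowUp₂ A B C = h.isArf.divBy hx (nonZeroDivisor hx1 hx2) := by
  have hn := nonZeroDivisor hx1 hx2
  apply le_antisymm
  · refine Algebra.adjoin_le ?_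
    rintro z ⟨y, hy, hy1, hy2, hz⟩
    obtain ⟨e₁, he₁⟩ := exists_mul_eq_of_order_le (ne_zero_of_order_eq_coe hx1)
      (hx1.trans hy1.symm).le
    obtain ⟨e₂, he₂⟩ := exists_mul_eq_of_order_le (ne_zero_of_order_eq_coe hx2)
      (hx2.trans hy2.symm).le
    have hye : y = x * (e₁, e₂) := Prod.ext he₁ he₂
    have ho₁ : e₁.order = (0 : ℕ) := order_eq_of_mul_eq hx1 (by simpa using hy1) he₁
    have ho₂ : e₂.order = (0 : ℕ) := order_eq_of_mul_eq hx2 (by simpa using hy2) he₂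
    obtain ⟨e', he'⟩ := (isUnit_prod (e := (e₁, e₂)) (order_eq_zero_iff.1 ho₁)
      (order_eq_zero_iff.1 ho₂)).exists_right_inv
    have heD : (e₁, e₂) ∈ h.isArf.divBy hx hn := by
      rw [h.isArf.mem_divBy, ← hye]
      exact hy
    have hezD : (e₁, e₂) * z ∈ h.isArf.divBy hx hn := by
      rw [h.isArf.mem_divBy, ← mul_assoc, ← hye]
      exact hz
    have : z = e' * ((e₁, e₂) * z) := by
      rw [← mul_assoc, mul_comm e', he', one_mul]
    rw [SetLike.mem_coe, this]
    exact mul_mem ((h.isArf.isArf_divBy hx hn).mem_of_mul_eq_one heD he') hezD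
  · exact fun z hz => Algebra.subset_adjoin ⟨x, hx, hx1, hx2, hz⟩

theorem mem_blowUp₂_iff (h : IsArfOver A B C) (hx : x ∈ C) (hx1 : x.1.order = mult A)
    (hx2 : x.2.order = mult B) : z ∈ blowUp₂ A B C ↔ x * z ∈ C := by
  rw [h.blowUp₂_eq hx hx1 hx2, h.isArf.mem_divBy]

theorem le_blowUp₂ (h : IsArfOver A B C) (hg : IsGlued C) : C ≤ blowUp₂ A B C := by
  obtain ⟨x, hx, hx1, hx2⟩ := h.exists_min hg
  exact fun z hz => (h.mem_blowUp₂_iff hx hx1 hx2).2 (C.mul_mem hx hz)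

theorem exists_eq_mul (h : IsArfOver A B C) (hg : IsGlued C) (hx : x ∈ C)
    (hx1 : x.1.order = mult A) (hx2 : x.2.order = mult B) (hz : z ∈ C)
    (h0 : constantCoeff z.1 = 0) : ∃ w ∈ blowUp₂ A B C, z = x * w := by
  obtain ⟨w₁, hw₁⟩ := exists_mul_eq_of_order_le (ne_zero_of_order_eq_coe hx1)
    (hx1 ▸ mult_le_order_of_mem_arfClosure h.one_le_mult_fst (h.fst_mem z hz) h0)
  obtain ⟨w₂, hw₂⟩ := exists_mul_eq_of_order_le (ne_zero_of_order_eq_coe hx2)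
    (hx2 ▸ mult_le_order_of_mem_arfClosure h.one_le_mult_snd (h.snd_mem z hz)
      ((hg z hz).symm.trans h0))
  have hzw : z = x * (w₁, w₂) := Prod.ext hw₁ hw₂
  exact ⟨(w₁, w₂), (h.mem_blowUp₂_iff hx hx1 hx2).2 (hzw ▸ hz), hzw⟩

theorem blowUp (h : IsArfOver A B C) (hg : IsGlued C) :
    IsArfOver (blowUp A) (blowUp B) (blowUp₂ A B C) := by
  obtain ⟨x, hx, hx1, hx2⟩ := h.exists_min hg
  have hn := nonZeroDivisor hx1 hx2
  have hArf : IsArf (blowUp₂ A B C) := by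
    rw [h.blowUp₂_eq hx hx1 hx2]
    exact h.isArf.isArf_divBy hx hn
  have hCond := h.hasConductor.mono (h.le_blowUp₂ hg)
  have hx01 := ne_zero_of_order_eq_coe hx1
  have hx02 := ne_zero_of_order_eq_coe hx2
  refine ⟨hArf, hCond, one_le_mult_blowUp h.one_le_mult_fst, one_le_mult_blowUp h.one_le_mult_snd,
    ?_, ?_, ?_, ?_⟩
  · suffices hle : AlgebroidCurve.blowUp A ≤ (blowUp₂ A B C).map (AlgHom.fst K _ _) from
      fun f hf => hle hf
    refine Algebra.adjoin_le ?_
    rintro z ⟨y, hy, hm, hyo, hyz⟩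
    have hy0 := constantCoeff_eq_zero_of_order_eq_mult hm hyo
    obtain ⟨p, hp, rfl⟩ := h.exists_fst y hy
    obtain ⟨q, hq, hqz⟩ := h.exists_fst _ hyz
    obtain ⟨e, he, rfl⟩ := h.exists_eq_mul hg hx hx1 hx2 hp hy0
    obtain ⟨w, hw, rfl⟩ := h.exists_eq_mul hg hx hx1 hx2 hq (by rw [hqz, map_mul, hy0, zero_mul])
    have heo : e.1.order = (0 : ℕ) := order_eq_of_mul_eq hx1 (by simpa using hyo) rfl
    obtain ⟨e', he', hee, he2⟩ := exists_isUnit_fst hCond he (order_eq_zero_iff.1 heo)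
    obtain ⟨u, hu⟩ := (isUnit_prod (hee ▸ order_eq_zero_iff.1 heo) he2).exists_right_inv
    refine ⟨u * w, mul_mem (hArf.mem_of_mul_eq_one he' hu) hw, ?_⟩
    have hw1 : w.1 = e.1 * z := by
      simp only [Prod.fst_mul, mul_assoc] at hqz
      exact mul_left_cancel₀ hx01 hqz
    have hu1 : e.1 * u.1 = 1 := by rw [← hee, ← Prod.fst_mul, hu, Prod.fst_one]
    change u.1 * w.1 = z
    rw [hw1]
    linear_combination z * hu1
  · suffices hle : AlgebroidCurve.blowUp B ≤ (blowUp₂ A B C).map (AlgHom.snd K _ _) from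
      fun f hf => hle hf
    refine Algebra.adjoin_le ?_
    rintro z ⟨y, hy, hm, hyo, hyz⟩
    have hy0 := constantCoeff_eq_zero_of_order_eq_mult hm hyo
    obtain ⟨p, hp, rfl⟩ := h.exists_snd y hy
    obtain ⟨q, hq, hqz⟩ := h.exists_snd _ hyz
    obtain ⟨e, he, rfl⟩ := h.exists_eq_mul hg hx hx1 hx2 hp ((hg p hp).trans hy0)
    obtain ⟨w, hw, rfl⟩ := h.exists_eq_mul hg hx hx1 hx2 hq
      ((hg q hq).trans (by rw [hqz, map_mul, hy0, zero_mul]))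
    have heo : e.2.order = (0 : ℕ) := order_eq_of_mul_eq hx2 (by simpa using hyo) rfl
    obtain ⟨e', he', hee, he1⟩ := exists_isUnit_snd hCond he (order_eq_zero_iff.1 heo)
    obtain ⟨u, hu⟩ := (isUnit_prod he1 (hee ▸ order_eq_zero_iff.1 heo)).exists_right_inv
    refine ⟨u * w, mul_mem (hArf.mem_of_mul_eq_one he' hu) hw, ?_⟩
    have hw1 : w.2 = e.2 * z := by
      simp only [Prod.snd_mul, mul_assoc] at hqz
      exact mul_left_cancel₀ hx02 hqz
    have hu1 : e.2 * u.2 = 1 := by rw [← hee, ← Prod.snd_mul, hu, Prod.snd_one]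
    change u.2 * w.2 = z
    rw [hw1]
    linear_combination z * hu1
  · exact fun z hz => (mem_arfClosure_blowUp_iff h.one_le_mult_fst (h.fst_mem x hx) hx1).2
      (h.fst_mem _ ((h.mem_blowUp₂_iff hx hx1 hx2).1 hz))
  · exact fun z hz => (mem_arfClosure_blowUp_iff h.one_le_mult_snd (h.snd_mem x hx) hx2).2
      (h.snd_mem _ ((h.mem_blowUp₂_iff hx hx1 hx2).1 hz))

/-- The first projection of `C` contains `A` and is Arf: lift a nonzerodivisor `y` to `(y, 1)`,
which lies in `C` thanks to the idempotents. -/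
theorem mk_zero_mem (h : IsArfOver A B C) (hg : ¬ IsGlued C) {f : PowerSeries K}
    (hf : f ∈ arfClosure A) : (f, 0) ∈ C := by
  have h10 := one_zero_mem h.hasConductor hg
  have h01 := zero_one_mem h.hasConductor hg
  have key : ∀ y ∈ C.map (AlgHom.fst K _ _), ((y, 0) : PowerSeries K × PowerSeries K) ∈ C := by
    rintro _ ⟨z, hz, rfl⟩
    convert C.mul_mem hz h10 using 1
    ext1 <;> simp
  refine key f (arfClosure_le ?_ (fun f hf => h.exists_fst f hf) hf)
  intro y hy hy0 v w hv hw
  have hy1 : (y, 1) ∈ C := by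
    convert C.add_mem (key y hy) h01 using 1
    ext1 <;> simp
  have := h.isArf (y, 1) hy1
    (mem_nonZeroDivisors_prod_iff.2 ⟨nonZeroDivisors.ne_zero hy0, one_ne_zero⟩) (v, 0) (w, 0)
    (by simpa using key _ hv) (by simpa using key _ hw)
  exact ⟨_, this, rfl⟩

theorem zero_mk_mem (h : IsArfOver A B C) (hg : ¬ IsGlued C) {f : PowerSeries K}
    (hf : f ∈ arfClosure B) : (0, f) ∈ C := by
  have h10 := one_zero_mem h.hasConductor hg
  have h01 := zero_one_mem h.hasConductor hg
  have key : ∀ y ∈ C.map (AlgHom.snd K _ _), ((0, y) : PowerSeries K × PowerSeries K) ∈ C := by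
    rintro _ ⟨z, hz, rfl⟩
    convert C.mul_mem hz h01 using 1
    ext1 <;> simp
  refine key f (arfClosure_le ?_ (fun f hf => h.exists_snd f hf) hf)
  intro y hy hy0 v w hv hw
  have hy1 : (1, y) ∈ C := by
    convert C.add_mem (key y hy) h10 using 1
    ext1 <;> simp
  have := h.isArf (1, y) hy1
    (mem_nonZeroDivisors_prod_iff.2 ⟨one_ne_zero, nonZeroDivisors.ne_zero hy0⟩) (0, v) (0, w)
    (by simpa using key _ hv) (by simpa using key _ hw)
  exact ⟨_, this, rfl⟩

end IsArfOver

/-- `C` and its first `N - 1` blow-ups are local. -/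
def IsGluedUpTo : ℕ → Subalgebra K (PowerSeries K) → Subalgebra K (PowerSeries K) →
    Subalgebra K (PowerSeries K × PowerSeries K) → Prop
  | 0, _, _, _ => True
  | N + 1, A, B, C => IsGlued C ∧ IsGluedUpTo N (blowUp A) (blowUp B) (blowUp₂ A B C)

/-! ### Values along the chain of local blow-ups -/

namespace IsArfOver

variable {A B : Subalgebra K (PowerSeries K)} {x z : PowerSeries K × PowerSeries K}

theorem exists_order_eq_sum (h : IsArfOver A B C) {N : ℕ} (hN : IsGluedUpTo N A B C) (hz : z ∈ C)
    (hlt : z.1.order < (∑ j ∈ Finset.range N, blowUpMult A j : ℕ) ∨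
      z.2.order < (∑ j ∈ Finset.range N, blowUpMult B j : ℕ)) :
    ∃ i < N, z.1.order = (∑ j ∈ Finset.range i, blowUpMult A j : ℕ) ∧
      z.2.order = (∑ j ∈ Finset.range i, blowUpMult B j : ℕ) := by
  induction N generalizing A B C z with
  | zero => simp at hlt
  | succ N ih =>
    obtain ⟨hg, hN⟩ := hN
    by_cases h0 : constantCoeff z.1 = 0
    · obtain ⟨x, hx, hx1, hx2⟩ := h.exists_min hg
      obtain ⟨w, hw, rfl⟩ := h.exists_eq_mul hg hx hx1 hx2 hz h0
      rw [Prod.fst_mul, Prod.snd_mul, order_mul, order_mul, hx1, hx2, sum_blowUpMult_succ,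
        sum_blowUpMult_succ, Nat.cast_add, Nat.cast_add,
        ENat.add_lt_add_iff_left (ENat.natCast_ne_top _),
        ENat.add_lt_add_iff_left (ENat.natCast_ne_top _)] at hlt
      obtain ⟨i, hi, hi1, hi2⟩ := ih (h.blowUp hg) hN hw hlt
      refine ⟨i + 1, by omega, ?_, ?_⟩
      · rw [Prod.fst_mul, order_mul, hx1, hi1, sum_blowUpMult_succ, Nat.cast_add]
      · rw [Prod.snd_mul, order_mul, hx2, hi2, sum_blowUpMult_succ, Nat.cast_add]
    · refine ⟨0, by omega, ?_, ?_⟩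
      · simpa using order_eq_zero_iff.2 h0
      · rw [hg z hz] at h0
        simpa using order_eq_zero_iff.2 h0

/-- The number of local rings among the iterated blow-ups is finite. -/
theorem exists_not_isGluedUpTo (h : IsArfOver A B C) : ∃ N, ¬ IsGluedUpTo N A B C := by
  obtain ⟨c, hc⟩ := h.hasConductor
  refine ⟨c + 1, fun hN => ?_⟩
  have hle : c + 1 ≤ ∑ j ∈ Finset.range (c + 1), blowUpMult B j := by
    calc c + 1 = ∑ j ∈ Finset.range (c + 1), 1 := by simp
      _ ≤ _ := Finset.sum_le_sum fun j _ => one_le_blowUpMult h.one_le_mult_snd j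
  -- The element `(0, u ^ c)` has a small second order but an infinite first order.
  obtain ⟨i, -, hi, -⟩ := h.exists_order_eq_sum hN
    (hc 0 (X ^ c) (by simp) (by simp)) (Or.inr (by
      rw [order_X_pow]
      exact_mod_cast hle))
  rw [order_zero] at hi
  exact ENat.natCast_ne_top _ hi.symm

theorem mem_valueSemigroup (h : IsArfOver A B C) {N n₁ n₂ : ℕ} (hN : IsGluedUpTo N A B C)
    (hN' : ¬ IsGluedUpTo (N + 1) A B C) (hn₁ : N ≤ n₁) (hn₂ : N ≤ n₂)
    (h₁ : ∀ j, n₁ ≤ j → blowUpMult A j = 1) (h₂ : ∀ j, n₂ ≤ j → blowUpMult B j = 1)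
    {a b : ℕ} (ha : ∑ j ∈ Finset.range n₁, blowUpMult A j ≤ a)
    (hb : ∑ j ∈ Finset.range n₂, blowUpMult B j ≤ b) : (a, b) ∈ valueSemigroup C := by
  induction N generalizing A B C n₁ n₂ a b with
  | zero =>
    have hg : ¬ IsGlued C := fun hg => hN' ⟨hg, trivial⟩
    obtain ⟨f, hf, hfo⟩ := exists_order_eq_of_sum_le h.one_le_mult_fst n₁ h₁ a ha
    obtain ⟨g, hg', hgo⟩ := exists_order_eq_of_sum_le h.one_le_mult_snd n₂ h₂ b hb
    exact ⟨_, C.add_mem (h.mk_zero_mem hg hf) (h.zero_mk_mem hg hg'), by simpa using hfo,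
      by simpa using hgo⟩
  | succ N ih =>
    obtain ⟨hg, hN⟩ := hN
    obtain ⟨m₁, rfl⟩ := Nat.exists_eq_add_of_le' (show 1 ≤ n₁ by omega)
    obtain ⟨m₂, rfl⟩ := Nat.exists_eq_add_of_le' (show 1 ≤ n₂ by omega)
    obtain ⟨x, hx, hx1, hx2⟩ := h.exists_min hg
    rw [sum_blowUpMult_succ] at ha hb
    obtain ⟨w, hw, hw1, hw2⟩ := ih (h.blowUp hg) hN (fun hN => hN' ⟨hg, hN⟩)
      (n₁ := m₁) (n₂ := m₂) (by omega) (by omega)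
      (fun j hj => by rw [blowUpMult_blowUp]; exact h₁ _ (by omega))
      (fun j hj => by rw [blowUpMult_blowUp]; exact h₂ _ (by omega))
      (a := a - mult A) (b := b - mult B) (by omega) (by omega)
    refine ⟨x * w, (h.mem_blowUp₂_iff hx hx1 hx2).1 hw, ?_, ?_⟩
    · rw [Prod.fst_mul, order_mul, hx1, hw1, ← Nat.cast_add]
      congr 1
      simp only
      omega
    · rw [Prod.snd_mul, order_mul, hx2, hw2, ← Nat.cast_add]
      congr 1
      simp only
      omega

end IsArfOver

end TwoBranches

/-! ### The indices `s` and the lengths of multiplicity sequences -/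

section Sequences

theorem sIndex_spec {M : ℕ → ℕ} {k s : ℕ} (hs : k + 1 ≤ s)
    (h : M k = ∑ j ∈ Finset.Icc (k + 1) s, M j) :
    k + 1 ≤ sIndex M k ∧ M k = ∑ j ∈ Finset.Icc (k + 1) (sIndex M k), M j :=
  Nat.sInf_mem (s := {s : ℕ | k + 1 ≤ s ∧ M k = ∑ j ∈ Finset.Icc (k + 1) s, M j}) ⟨s, hs, h⟩

theorem sum_Icc_lt_sum_Icc {M : ℕ → ℕ} (hM : ∀ j, 1 ≤ M j) {a s t : ℕ} (ha : a ≤ t) (hst : s < t) :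
    ∑ j ∈ Finset.Icc a s, M j < ∑ j ∈ Finset.Icc a t, M j := by
  refine Finset.sum_lt_sum_of_subset (i := t) (Finset.Icc_subset_Icc_right hst.le) ?_ ?_ (hM t)
    (fun _ _ _ => Nat.zero_le _)
  · exact Finset.mem_Icc.2 ⟨ha, le_rfl⟩
  · simp only [Finset.mem_Icc]
    omega

theorem sIndex_eq {M : ℕ → ℕ} (hM : ∀ j, 1 ≤ M j) {k s : ℕ} (hs : k + 1 ≤ s)
    (h : M k = ∑ j ∈ Finset.Icc (k + 1) s, M j) : sIndex M k = s := by
  obtain ⟨h1, h2⟩ := sIndex_spec hs h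
  rcases lt_trichotomy (sIndex M k) s with hlt | heq | hlt
  · exact absurd (h2.symm.trans h) (sum_Icc_lt_sum_Icc hM hs hlt).ne
  · exact heq
  · exact absurd (h.symm.trans h2) (sum_Icc_lt_sum_Icc hM h1 hlt).ne

theorem eq_one_of_seqLength_lt {M : ℕ → ℕ} {n : ℕ} (hn : ∀ j, n ≤ j → M j = 1) {j : ℕ}
    (hj : seqLength M < j) : M j = 1 := by
  by_contra hc
  have hb : BddAbove {j : ℕ | 1 ≤ j ∧ M j ≠ 1} :=
    ⟨n, fun i hi => le_of_not_ge fun h => hi.2 (hn i h)⟩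
  have : j ≤ sSup {j : ℕ | 1 ≤ j ∧ M j ≠ 1} :=
    le_csSup hb ⟨le_trans (le_max_left _ _) hj.le, hc⟩
  exact absurd (this.trans (le_max_right 1 _)) (not_le.2 hj)

theorem seqLength_eq_one_or {M : ℕ → ℕ} {n : ℕ} (hn : ∀ j, n ≤ j → M j = 1) :
    seqLength M = 1 ∨ M (seqLength M) ≠ 1 := by
  by_cases hne : {j : ℕ | 1 ≤ j ∧ M j ≠ 1}.Nonempty
  · have hb : BddAbove {j : ℕ | 1 ≤ j ∧ M j ≠ 1} :=
      ⟨n, fun i hi => le_of_not_ge fun h => hi.2 (hn i h)⟩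
    have hm := Nat.sSup_mem hne hb
    right
    rw [seqLength, max_eq_right hm.1]
    exact hm.2
  · left
    rw [Set.not_nonempty_iff_eq_empty] at hne
    simp [seqLength, hne]

end Sequences

section MultSeq

variable {A B : Subalgebra K (PowerSeries K)}

theorem multSeq_succ (A : Subalgebra K (PowerSeries K)) (j : ℕ) :
    multSeq A (j + 1) = blowUpMult A j := rfl

theorem one_le_multSeq (h : 1 ≤ mult A) (j : ℕ) : 1 ≤ multSeq A j :=
  one_le_blowUpMult h (j - 1)

theorem sum_Icc_multSeq (A : Subalgebra K (PowerSeries K)) (k i : ℕ) :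
    ∑ j ∈ Finset.Icc (k + 1) (k + i), multSeq A j = ∑ j ∈ Finset.range i, blowUpMult A (k + j) := by
  rw [← Finset.Ico_add_one_right_eq_Icc, Finset.sum_Ico_eq_sum_range]
  have : k + i + 1 - (k + 1) = i := by omega
  rw [this]
  refine Finset.sum_congr rfl fun j _ => ?_
  rw [← multSeq_succ]
  congr 1
  omega

theorem sum_Icc_one_multSeq (A : Subalgebra K (PowerSeries K)) (n : ℕ) :
    ∑ j ∈ Finset.Icc 1 n, multSeq A j = ∑ j ∈ Finset.range n, blowUpMult A j := by
  simpa using sum_Icc_multSeq A 0 n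

theorem le_sum_blowUpMult (h : 1 ≤ mult A) (k n : ℕ) :
    n ≤ ∑ j ∈ Finset.range n, blowUpMult A (k + j) := by
  calc n = ∑ j ∈ Finset.range n, 1 := by simp
    _ ≤ _ := Finset.sum_le_sum fun j _ => one_le_blowUpMult h _

/-- A minimal element of a ring lies in its blow-up, and small orders there are partial sums of the
later multiplicities. This makes `sIndex` meaningful. -/
theorem exists_blowUpMult_eq_sum (h : 1 ≤ mult A) (k : ℕ) :
    ∃ i, blowUpMult A k = ∑ j ∈ Finset.range i, blowUpMult A (k + 1 + j) := by
  induction k generalizing A with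
  | zero =>
    obtain ⟨x, hx, hxo⟩ := exists_order_eq_mult h
    have h' := one_le_mult_blowUp h
    have hle := le_sum_blowUpMult h' 0 (mult A + 1)
    simp only [zero_add] at hle
    obtain ⟨i, -, hi⟩ := order_eq_sum_of_lt h' (mult A + 1) (le_arfClosure _ (le_blowUp h hx))
      (by rw [hxo]; exact_mod_cast hle)
    rw [hxo] at hi
    refine ⟨i, ?_⟩
    rw [blowUpMult_zero, ENat.natCast_inj.1 hi]
    refine Finset.sum_congr rfl fun j _ => ?_
    rw [blowUpMult_blowUp]
    congr 1
    omega
  | succ k ih =>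
    obtain ⟨i, hi⟩ := ih (one_le_mult_blowUp h)
    refine ⟨i, ?_⟩
    rw [← blowUpMult_blowUp, hi]
    refine Finset.sum_congr rfl fun j _ => ?_
    rw [blowUpMult_blowUp]
    congr 1
    omega

theorem sIndex_multSeq_spec (h : 1 ≤ mult A) {k : ℕ} (hk : 1 ≤ k) :
    k + 1 ≤ sIndex (multSeq A) k ∧
      multSeq A k = ∑ j ∈ Finset.Icc (k + 1) (sIndex (multSeq A) k), multSeq A j := by
  obtain ⟨k, rfl⟩ := Nat.exists_eq_add_of_le' hk
  obtain ⟨i, hi⟩ := exists_blowUpMult_eq_sum h k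
  have hi0 : i ≠ 0 := by
    rintro rfl
    have := one_le_blowUpMult h k
    simp at hi
    omega
  refine sIndex_spec (s := k + 1 + i) (by omega) ?_
  rw [sum_Icc_multSeq, multSeq_succ, hi]

/-- Downward induction: beyond both lengths all terms are 1, and `M[k]` is determined by `sₖ` and
the later terms. -/
theorem multSeq_eq_of_sIndex_eq (hA : 1 ≤ mult A) (hB : 1 ≤ mult B) {n₁ n₂ : ℕ}
    (hn₁ : ∀ j, n₁ ≤ j → multSeq A j = 1) (hn₂ : ∀ j, n₂ ≤ j → multSeq B j = 1)
    (h : ∀ k, 1 ≤ k → k ≤ max (seqLength (multSeq A)) (seqLength (multSeq B)) →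
      sIndex (multSeq A) k = sIndex (multSeq B) k) {k : ℕ} (hk : 1 ≤ k) :
    multSeq A k = multSeq B k := by
  set L := max (seqLength (multSeq A)) (seqLength (multSeq B)) with hL
  have hbig : ∀ k, L < k → multSeq A k = multSeq B k := fun k hk => by
    rw [eq_one_of_seqLength_lt hn₁ (lt_of_le_of_lt (le_max_left _ _) hk),
      eq_one_of_seqLength_lt hn₂ (lt_of_le_of_lt (le_max_right _ _) hk)]
  suffices ∀ t k, 1 ≤ k → L < k + t → multSeq A k = multSeq B k from
    this (L + 1) k hk (by omega)
  intro t
  induction t with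
  | zero => exact fun k _ hk => hbig k hk
  | succ t ih =>
    intro k hk hkt
    by_cases hkL : L < k
    · exact hbig k hkL
    rw [(sIndex_multSeq_spec hA hk).2, (sIndex_multSeq_spec hB hk).2, h k hk (by omega)]
    refine Finset.sum_congr rfl fun j hj => ?_
    rw [Finset.mem_Icc] at hj
    exact ih j (by omega) (by omega)

theorem exists_multSeq_eq_one (h : 1 ≤ mult A)
    (hfrac : ∀ f : PowerSeries K, ∃ a ∈ A, ∃ b ∈ A, b ≠ 0 ∧ b * f = a) :
    ∃ n, ∀ j, n ≤ j → multSeq A j = 1 := by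
  obtain ⟨a, ha, b, hb, hb0, hab⟩ := hfrac X
  obtain ⟨n, hn⟩ := exists_blowUpMult_eq_one h ha hb hb0 hab
  exact ⟨n + 1, fun j hj => hn (j - 1) (by omega)⟩

theorem one_le_mult_of_frac
    (hfrac : ∀ f : PowerSeries K, ∃ a ∈ A, ∃ b ∈ A, b ≠ 0 ∧ b * f = a) : 1 ≤ mult A := by
  obtain ⟨a, ha, b, hb, hb0, hab⟩ := hfrac X
  refine one_le_mult ha (d := b.order.toNat + 1) (by omega) ?_
  rw [← hab, order_mul, order_X, Nat.cast_add, coe_toNat_order hb0, Nat.cast_one]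

theorem sum_seqLength_le_branchConductor (h : 1 ≤ mult A) {n : ℕ}
    (hn : ∀ j, n ≤ j → multSeq A j = 1) (hl : multSeq A (seqLength (multSeq A)) ≠ 1) :
    ∑ j ∈ Finset.range (seqLength (multSeq A)), blowUpMult A j ≤ branchConductor A := by
  have hne : {c : ℕ | ∀ m : ℕ, c ≤ m → ∃ f ∈ arfClosure A, f.order = (m : ℕ∞)}.Nonempty :=
    ⟨_, fun m hm => exists_order_eq_of_sum_le h n (fun j hj => hn (j + 1) (by omega)) m hm⟩
  have hc : ∀ m : ℕ, branchConductor A ≤ m → ∃ f ∈ arfClosure A, f.order = (m : ℕ∞) :=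
    Nat.sInf_mem hne
  obtain ⟨l, hl'⟩ : ∃ l, seqLength (multSeq A) = l + 1 :=
    Nat.exists_eq_add_of_le' (le_max_left _ _)
  rw [hl', multSeq_succ] at hl
  rw [hl', Finset.sum_range_succ]
  have h1 := one_le_blowUpMult h l
  by_contra hlt
  -- One less than the sum of the first `l + 1` multiplicities: as the last of them is at least 2,
  -- this lies strictly between consecutive partial sums and is not a value.
  obtain ⟨f, hf, hfo⟩ := hc (∑ j ∈ Finset.range l, blowUpMult A j + blowUpMult A l - 1) (by omega)
  obtain ⟨i, hi, hio⟩ := order_eq_sum_of_lt h (l + 1) hf (by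
    rw [hfo, Finset.sum_range_succ]
    exact_mod_cast (by omega))
  rw [hfo, ENat.natCast_inj] at hio
  have : ∑ j ∈ Finset.range i, blowUpMult A j ≤ ∑ j ∈ Finset.range l, blowUpMult A j :=
    Finset.sum_le_sum_of_subset (Finset.range_subset_range.2 (by omega))
  omega

end MultSeq

/-! ### Bounds for the number of local blow-ups -/

namespace IsArfOver

variable {A B : Subalgebra K (PowerSeries K)} {C : Subalgebra K (PowerSeries K × PowerSeries K)}

theorem exists_blowUpMult_eq_sum (h : IsArfOver A B C) (k : ℕ) {r : ℕ}
    (hN : IsGluedUpTo (k + 1 + r) A B C)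
    (hlt : blowUpMult A k < ∑ j ∈ Finset.range r, blowUpMult A (k + 1 + j) ∨
      blowUpMult B k < ∑ j ∈ Finset.range r, blowUpMult B (k + 1 + j)) :
    ∃ i, blowUpMult A k = ∑ j ∈ Finset.range i, blowUpMult A (k + 1 + j) ∧
      blowUpMult B k = ∑ j ∈ Finset.range i, blowUpMult B (k + 1 + j) := by
  induction k generalizing A B C with
  | zero =>
    rw [show 0 + 1 + r = r + 1 by omega] at hN
    obtain ⟨hg, hN⟩ := hN
    obtain ⟨x, hx, hx1, hx2⟩ := h.exists_min hg
    have hs : ∀ (A : Subalgebra K (PowerSeries K)) (i : ℕ),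
        ∑ j ∈ Finset.range i, blowUpMult A (0 + 1 + j) =
          ∑ j ∈ Finset.range i, blowUpMult (AlgebroidCurve.blowUp A) j := by
      intro A i
      refine Finset.sum_congr rfl fun j _ => ?_
      rw [blowUpMult_blowUp]
      congr 1
      omega
    simp only [hs, blowUpMult_zero] at hlt ⊢
    obtain ⟨i, -, hi1, hi2⟩ := (h.blowUp hg).exists_order_eq_sum hN (h.le_blowUp₂ hg hx)
      (by rw [hx1, hx2]; exact_mod_cast hlt)
    rw [hx1, ENat.natCast_inj] at hi1
    rw [hx2, ENat.natCast_inj] at hi2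
    exact ⟨i, hi1, hi2⟩
  | succ k ih =>
    rw [show k + 1 + 1 + r = (k + 1 + r) + 1 by omega] at hN
    obtain ⟨hg, hN⟩ := hN
    have hs : ∀ (A : Subalgebra K (PowerSeries K)) (i : ℕ),
        ∑ j ∈ Finset.range i, blowUpMult A (k + 1 + 1 + j) =
          ∑ j ∈ Finset.range i, blowUpMult (AlgebroidCurve.blowUp A) (k + 1 + j) := by
      intro A i
      refine Finset.sum_congr rfl fun j _ => ?_
      rw [blowUpMult_blowUp]
      congr 1
      omega
    simp only [hs, ← blowUpMult_blowUp] at hlt ⊢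
    exact ih (h.blowUp hg) hN hlt

theorem isGluedUpTo_mono {m n : ℕ} (hmn : m ≤ n) (h : IsGluedUpTo n A B C) :
    IsGluedUpTo m A B C := by
  induction m generalizing n A B C with
  | zero => trivial
  | succ m ih =>
    obtain ⟨n, rfl⟩ := Nat.exists_eq_add_of_le' (show 1 ≤ n by omega)
    exact ⟨h.1, ih (by omega) h.2⟩

theorem exists_last_glued (h : IsArfOver A B C) :
    ∃ N, IsGluedUpTo N A B C ∧ ¬ IsGluedUpTo (N + 1) A B C := by
  classical
  have hex := h.exists_not_isGluedUpTo
  obtain ⟨N, hN⟩ := Nat.exists_eq_succ_of_ne_zero (n := Nat.find hex) (by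
    intro h0
    have := Nat.find_spec hex
    rw [h0] at this
    exact this trivial)
  refine ⟨N, not_not.1 (Nat.find_min hex (by omega)), ?_⟩
  have := Nat.find_spec hex
  rwa [hN] at this

/-- The number of local rings among the iterated blow-ups is at most `min (s₁ₖ, s₂ₖ)` when
`s₁ₖ ≠ s₂ₖ`. -/
theorem le_min_sIndex (h : IsArfOver A B C) {N : ℕ} (hN : IsGluedUpTo N A B C) {k : ℕ}
    (hk : 1 ≤ k) (hs : sIndex (multSeq A) k ≠ sIndex (multSeq B) k) :
    N ≤ min (sIndex (multSeq A) k) (sIndex (multSeq B) k) := by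
  have hA := h.one_le_mult_fst
  have hB := h.one_le_mult_snd
  obtain ⟨hA1, hA2⟩ := sIndex_multSeq_spec hA hk
  obtain ⟨hB1, hB2⟩ := sIndex_multSeq_spec hB hk
  by_contra hlt
  obtain ⟨k, rfl⟩ := Nat.exists_eq_add_of_le' hk
  obtain ⟨r, hr⟩ := Nat.exists_eq_add_of_le
    (show k + 1 ≤ min (sIndex (multSeq A) (k + 1)) (sIndex (multSeq B) (k + 1)) by omega)
  -- Since `N ≥ k + 1 + (r + 1)`, one more term than the shorter expansion uses is available, and it
  -- overshoots on the branch where the minimum is attained.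
  have key : blowUpMult A k < ∑ j ∈ Finset.range (r + 1), blowUpMult A (k + 1 + j) ∨
      blowUpMult B k < ∑ j ∈ Finset.range (r + 1), blowUpMult B (k + 1 + j) := by
    rw [← sum_Icc_multSeq, ← sum_Icc_multSeq, ← multSeq_succ, ← multSeq_succ]
    rcases min_choice (sIndex (multSeq A) (k + 1)) (sIndex (multSeq B) (k + 1)) with hm | hm
    · left
      rw [hm] at hr
      rw [hA2]
      exact sum_Icc_lt_sum_Icc (one_le_multSeq hA) (by omega) (by omega)
    · right
      rw [hm] at hr
      rw [hB2]
      exact sum_Icc_lt_sum_Icc (one_le_multSeq hB) (by omega) (by omega)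
  obtain ⟨i, hi1, hi2⟩ := h.exists_blowUpMult_eq_sum k (isGluedUpTo_mono (by omega) hN) key
  have hi0 : 1 ≤ i := by
    rw [Nat.one_le_iff_ne_zero]
    rintro rfl
    have := one_le_blowUpMult hA k
    simp at hi1
    omega
  rw [← sum_Icc_multSeq, ← multSeq_succ] at hi1 hi2
  exact hs ((sIndex_eq (one_le_multSeq hA) (by omega) hi1).trans
    (sIndex_eq (one_le_multSeq hB) (by omega) hi2).symm)

end IsArfOver

/-! ### The bounds for the conductor -/

namespace Parametrization

variable {n : ℕ} {P : Parametrization K n}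

theorem IsAlgebroidCurve.isArfOver (hP : P.IsAlgebroidCurve) :
    IsArfOver P.branch₁ P.branch₂ (arfClosure P.curveRing) := by
  have hle : arfClosure P.curveRing ≤ (arfClosure P.branch₁).prod (arfClosure P.branch₂) := by
    refine arfClosure_le (isArf_prod (isArf_arfClosure _) (isArf_arfClosure _)) fun z hz => ?_
    obtain ⟨F, h1, h2⟩ := P.mem_curveRing.1 hz
    exact ⟨le_arfClosure _ ⟨F, h1⟩, le_arfClosure _ ⟨F, h2⟩⟩
  refine ⟨isArf_arfClosure _, hP.hasConductor.mono (le_arfClosure _), one_le_mult_of_frac hP.frac₁,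
    one_le_mult_of_frac hP.frac₂, ?_, ?_, fun z hz => (hle hz).1, fun z hz => (hle hz).2⟩
  · rintro _ ⟨F, rfl⟩
    exact ⟨(P.hom₁ F, P.hom₂ F), le_arfClosure _ (P.mem_curveRing.2 ⟨F, rfl, rfl⟩), rfl⟩
  · rintro _ ⟨F, rfl⟩
    exact ⟨(P.hom₁ F, P.hom₂ F), le_arfClosure _ (P.mem_curveRing.2 ⟨F, rfl, rfl⟩), rfl⟩

theorem IsAlgebroidCurve.exists_M₁_eq_one (hP : P.IsAlgebroidCurve) :
    ∃ n, ∀ j, n ≤ j → P.M₁ j = 1 :=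
  exists_multSeq_eq_one (one_le_mult_of_frac hP.frac₁) hP.frac₁

theorem IsAlgebroidCurve.exists_M₂_eq_one (hP : P.IsAlgebroidCurve) :
    ∃ n, ∀ j, n ≤ j → P.M₂ j = 1 :=
  exists_multSeq_eq_one (one_le_mult_of_frac hP.frac₂) hP.frac₂

/-- `b - (1, 1)` and all larger vectors are values of the Arf closure. -/
def IsConductorBound (P : Parametrization K n) (b : ℕ × ℕ) : Prop :=
  ∃ δ : ℕ × ℕ, b = (δ.1 + 1, δ.2 + 1) ∧ ∀ β, δ ≤ β → β ∈ valueSemigroup (arfClosure P.curveRing)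

theorem IsConductorBound.inf {b b' : ℕ × ℕ} (h : P.IsConductorBound b)
    (h' : P.IsConductorBound b') : P.IsConductorBound (b ⊓ b') := by
  obtain ⟨δ, rfl, hδ⟩ := h
  obtain ⟨ε, rfl, hε⟩ := h'
  exact ⟨δ ⊓ ε, by ext <;> simp [min_add_add_right], inf_mem_conductors hδ hε⟩

theorem IsConductorBound.of_curveRing_le {Q : Parametrization K n} {b : ℕ × ℕ}
    (h : Q.IsConductorBound b) (hle : Q.curveRing ≤ P.curveRing) : P.IsConductorBound b := by
  obtain ⟨δ, hb, hδ⟩ := h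
  refine ⟨δ, hb, fun β hβ => ?_⟩
  obtain ⟨f, hf, hf'⟩ := hδ β hβ
  exact ⟨f, arfClosure_mono hle hf, hf'⟩

theorem IsAlgebroidCurve.isConductorBound_bO (hP : P.IsAlgebroidCurve) (hD : P.D.Nonempty) :
    P.IsConductorBound P.bO := by
  have h := hP.isArfOver
  obtain ⟨N, hN, hN'⟩ := h.exists_last_glued
  obtain ⟨n₁, hn₁⟩ := hP.exists_M₁_eq_one
  obtain ⟨n₂, hn₂⟩ := hP.exists_M₂_eq_one
  have hNk : N ≤ P.kE := by
    obtain ⟨k, ⟨hk, -, hs⟩, hkE⟩ := Nat.sInf_mem (hD.image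
      (fun k => min (sIndex P.M₁ k) (sIndex P.M₂ k)))
    rw [kE, ← hkE]
    exact h.le_min_sIndex hN hk hs
  refine ⟨(_, _), rfl, fun β hβ => ?_⟩
  refine h.mem_valueSemigroup hN hN' (hNk.trans (le_max_right (seqLength P.M₁) _))
    (hNk.trans (le_max_right (seqLength P.M₂) _))
    (fun j hj => eq_one_of_seqLength_lt hn₁ (Nat.lt_succ_of_le (le_trans (le_max_left _ _) hj)))
    (fun j hj => eq_one_of_seqLength_lt hn₂ (Nat.lt_succ_of_le (le_trans (le_max_left _ _) hj)))
    ?_ ?_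
  · rw [← sum_Icc_one_multSeq]
    exact hβ.1
  · rw [← sum_Icc_one_multSeq]
    exact hβ.2

theorem IsAlgebroidCurve.M₁_eq_M₂ (hP : P.IsAlgebroidCurve) (hD : P.D = ∅) {k : ℕ} (hk : 1 ≤ k) :
    P.M₁ k = P.M₂ k := by
  obtain ⟨n₁, hn₁⟩ := hP.exists_M₁_eq_one
  obtain ⟨n₂, hn₂⟩ := hP.exists_M₂_eq_one
  refine multSeq_eq_of_sIndex_eq (one_le_mult_of_frac hP.frac₁) (one_le_mult_of_frac hP.frac₂)
    hn₁ hn₂ (fun k hk hkL => ?_) hk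
  by_contra hne
  exact Set.notMem_empty k (hD ▸ (⟨hk, hkL, hne⟩ : k ∈ P.D))

theorem IsAlgebroidCurve.isConductorBound_of_order_ne (hP : P.IsAlgebroidCurve) (hD : P.D = ∅)
    {z : PowerSeries K × PowerSeries K} (hz : z ∈ P.curveRing) (hne : z.1.order ≠ z.2.order)
    {d : ℕ} (hd1 : 1 ≤ d) (hd : (d : ℕ∞) = min z.1.order z.2.order) :
    P.IsConductorBound (max P.cr d + 1, max P.cr d + 1) := by
  have h := hP.isArfOver
  obtain ⟨N, hN, hN'⟩ := h.exists_last_glued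
  obtain ⟨n₁, hn₁⟩ := hP.exists_M₁_eq_one
  obtain ⟨n₂, hn₂⟩ := hP.exists_M₂_eq_one
  have hM : ∀ j, blowUpMult P.branch₁ j = blowUpMult P.branch₂ j :=
    fun j => hP.M₁_eq_M₂ hD (Nat.le_add_left 1 j)
  have hNd : ∑ j ∈ Finset.range N, blowUpMult P.branch₁ j ≤ d := by
    by_contra hlt
    obtain ⟨i, -, hi1, hi2⟩ := h.exists_order_eq_sum hN (le_arfClosure _ hz) (by
      simp only [← hM]
      rw [← min_lt_iff, ← hd]
      exact_mod_cast not_le.1 hlt)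
    refine hne (hi1.trans ?_)
    rw [hi2]
    simp only [hM]
  have hsum : ∑ j ∈ Finset.range (max (seqLength P.M₁) N), blowUpMult P.branch₁ j ≤
      max P.cr d := by
    rcases le_total (seqLength P.M₁) N with hl | hl
    · rw [max_eq_right hl]
      exact hNd.trans (le_max_right _ _)
    rw [max_eq_left hl]
    -- If all multiplicities are 1, the length is 1 by convention and the sum is 1, while the
    -- conductor is 0; then `1 ≤ d` is what saves the bound.
    by_cases h1 : P.M₁ (seqLength P.M₁) = 1
    · have hl1 := (seqLength_eq_one_or hn₁).resolve_right (not_not.2 h1)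
      rw [hl1] at h1 ⊢
      refine le_trans ?_ (le_max_right _ _)
      rw [Finset.sum_range_one]
      exact h1.le.trans hd1
    · exact (sum_seqLength_le_branchConductor h.one_le_mult_fst hn₁ h1).trans (le_max_left _ _)
  have hone : ∀ j, max (seqLength P.M₁) N ≤ j → blowUpMult P.branch₁ j = 1 := fun j hj =>
    eq_one_of_seqLength_lt hn₁ (Nat.lt_succ_of_le (le_trans (le_max_left _ _) hj))
  refine ⟨(max P.cr d, max P.cr d), rfl, fun β hβ => ?_⟩
  refine h.mem_valueSemigroup hN hN' (le_max_right (seqLength P.M₁) N)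
    (le_max_right (seqLength P.M₁) N) hone (fun j hj => (hM j) ▸ hone j hj)
    (hsum.trans hβ.1) ?_
  simp only [← hM]
  exact hsum.trans hβ.2

/-- A discrepancy of the generators of a subring gives a bound for the conductor. -/
theorem IsAlgebroidCurve.isConductorBound_of_dis (hP : P.IsAlgebroidCurve) (hD : P.D = ∅)
    {Q : Parametrization K n} (hle : Q.curveRing ≤ P.curveRing) (hQ : Q.Dis.Nonempty) :
    P.IsConductorBound (max P.cr Q.disOrder + 1, max P.cr Q.disOrder + 1) := by
  have hne : {d : ℕ | ∃ i ∈ Q.Dis, (d : ℕ∞) = min (Q.φ i).order (Q.ψ i).order}.Nonempty := by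
    obtain ⟨i, hi⟩ := hQ
    have htop : min (Q.φ i).order (Q.ψ i).order ≠ ⊤ := by
      intro h
      rw [min_eq_top] at h
      exact hi (h.1.trans h.2.symm)
    -- The minimum is finite, as two infinite orders would be equal.
    exact ⟨_, i, hi, ENat.natCast_toNat htop⟩
  obtain ⟨i, hi, hd⟩ := Nat.sInf_mem hne
  refine hP.isConductorBound_of_order_ne hD (z := (Q.φ i, Q.ψ i))
    (hle (Q.mem_curveRing.2 ⟨_, Q.hom₁_X i, Q.hom₂_X i⟩)) hi ?_ hd
  have h1 : (1 : ℕ∞) ≤ min (Q.φ i).order (Q.ψ i).order :=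
    le_min (one_le_order_iff_constCoeff_eq_zero.2 (Q.φ_zero i))
      (one_le_order_iff_constCoeff_eq_zero.2 (Q.ψ_zero i))
  rw [← hd] at h1
  exact_mod_cast h1

/-- The first two kinds of bound are proved for `Q` and transferred to the larger ring; the third
treats a generator of `Q` as an element of the original ring. -/
theorem IsAlgebroidCurve.isConductorBound_of_isBG (hP : P.IsAlgebroidCurve) (hD : P.D = ∅)
    {b : ℕ × ℕ} (hb : P.IsBG b) : P.IsConductorBound b := by
  obtain ⟨Q, hPQ, h⟩ := hb
  have hle := curveRing_le_of_reflTransGen hPQ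
  rcases h with ⟨hQ, hQD, rfl⟩ | ⟨hQ, hQD, hQdis, rfl⟩ | ⟨hQdis, rfl⟩
  · exact (hQ.isConductorBound_bO hQD).of_curveRing_le hle
  · exact (hQ.isConductorBound_of_dis hQD le_rfl hQdis).of_curveRing_le hle
  · exact hP.isConductorBound_of_dis hD hle hQdis

theorem IsAlgebroidCurve.isConductorBound (hP : P.IsAlgebroidCurve) {b : ℕ × ℕ}
    (hb : P.IsBound b) : P.IsConductorBound b := by
  rcases hb with ⟨hD, rfl⟩ | ⟨hD, hdis, bG, hG, rfl⟩ | ⟨hD, -, hG⟩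
  · exact hP.isConductorBound_bO hD
  · exact (hP.isConductorBound_of_dis hD le_rfl hdis).inf (hP.isConductorBound_of_isBG hD hG)
  · exact hP.isConductorBound_of_isBG hD hG

end Parametrization

end AlgebroidCurve

theorem proposition4p6 {K : Type*} [Field K] {n : ℕ}
    (P : AlgebroidCurve.Parametrization K n) (hP : P.IsAlgebroidCurve)
    (b : ℕ × ℕ) (hb : P.IsBound b) :
    ∃ c : ℕ × ℕ,
      AlgebroidCurve.IsConductor
        (AlgebroidCurve.valueSemigroup (AlgebroidCurve.arfClosure P.curveRing)) c ∧
      (c.1 + 1, c.2 + 1) ≤ b := by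
  obtain ⟨δ, rfl, hδ⟩ := hP.isConductorBound hb
  obtain ⟨c, hc⟩ := AlgebroidCurve.exists_isConductor hδ
  have hle : c ≤ δ := hc.2 hδ
  exact ⟨c, hc, Nat.succ_le_succ hle.1, Nat.succ_le_succ hle.2⟩
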